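/- Let $q\ge 1$ and let $0\le\theta_0<\theta_1<\dots<\theta_{q-1}$ be fixed integers. For $\beta>1$ let $T_\beta x=\beta x-\lfloor\beta x\rfloor$; the $\beta$-expansion of $x\in[0,1)$ is $x=\sum_{k\ge1}a_k\beta^{-k}$ with digits $a_k=\lfloor\beta T_\beta^{k-1}x\rfloor$. For $\beta>\max(1,\theta_{q-1})$ let $C_\beta=C_{\beta;\theta_0\cdots\theta_{q-1}}$ be the closure of the set of all $x\in[0,1)$ whose $\beta$-expansion has all its digits in $\{\theta_0,\dots,\theta_{q-1}\}$. Then the Hausdorff dimension $\dim_H C_\beta$ is a continuous function of $\beta$ on $\{\beta:\beta>\max(1,\theta_{q-1})\}$. Moreover, let $\Sigma_\beta$ be the closure, in the product topology, of the set of digit sequences of the $\beta$-expansions of points of $[0,1)$ with all digits in $\{\theta_0,\dots,\theta_{q-1}\}$. If $\Sigma_\beta$ has a lexicographically largest element $(z_1,z_2,\dots)$, put $\omega_i=j$ when $z_i=\theta_j$, and let $\alpha_\beta$ be the positive number with $1=\sum_{i\ge1}\omega_i\alpha_\beta^{-i}$, when there is one. For $\beta>\max(1,\theta_{q-1})$ such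 a number $\alpha_\beta$ exists and is unique whenever $C_\beta$ has at least two points; $\alpha_\beta\le\alpha_{\beta'}$ whenever $\max(1,\theta_{q-1})<\beta\le\beta'$ and both numbers are defined; and if $q\ge2$, then every number in $(q-1,q]$ is equal to $\alpha_\beta$ for some $\beta>\max(1,\theta_{q-1})$. -/

import Mathlib

open Set Topology

noncomputable section

/-- The `β`-transformation `x ↦ β x - ⌊β x⌋`. -/
def betaT (β x : ℝ) : ℝ := Int.fract (β * x)

/-- The digits of the `β`-expansion of `x ∈ [0, 1)`, indexed from `0`:
`betaDigit β x n = ⌊β T_β^n x⌋` is the coefficient of `β ^ (-(n + 1))`. -/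
def betaDigit (β x : ℝ) (n : ℕ) : ℕ := ⌊β * (betaT β)^[n] x⌋₊

/-- The Cantor-type set `C_{β;θ}`: the closure of the set of all `x ∈ [0, 1)` all of whose
`β`-expansion digits belong to `{θ 0, …, θ (q - 1)}`. -/
def betaCantorSet {q : ℕ} (θ : Fin q → ℕ) (β : ℝ) : Set ℝ :=
  closure {x : ℝ | x ∈ Ico (0 : ℝ) 1 ∧ ∀ n, betaDigit β x n ∈ range θ}

/-- The space `Σ_{β;θ}`: the closure, in the product topology, of the set of the digit sequences
of those `β`-expansions of points of `[0, 1)` that only use the digits `θ 0, …, θ (q - 1)`. -/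
def digitShift {q : ℕ} (θ : Fin q → ℕ) (β : ℝ) : Set (ℕ → ℕ) :=
  closure {a : ℕ → ℕ | ∃ x ∈ Ico (0 : ℝ) 1, a = betaDigit β x ∧ ∀ n, a n ∈ range θ}

/-- `z` is the lexicographically largest element of `Σ_{β;θ}`. -/
def IsMaxSeq {q : ℕ} (θ : Fin q → ℕ) (β : ℝ) (z : ℕ → ℕ) : Prop :=
  z ∈ digitShift θ β ∧ ∀ a ∈ digitShift θ β, toLex a ≤ toLex z

/-- `α = α_{β;θ}`: if `z` is the largest sequence of `Σ_{β;θ}` and `z i = θ (ω i)` for all `i`, then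
`α` is the positive number with `1 = ω 0 / α + ω 1 / α ^ 2 + ⋯`. -/
def IsAlpha {q : ℕ} (θ : Fin q → ℕ) (β α : ℝ) : Prop :=
  0 < α ∧ ∃ ω : ℕ → Fin q, IsMaxSeq θ β (fun i => θ (ω i)) ∧
    HasSum (fun i => ((ω i : ℕ) : ℝ) / α ^ (i + 1)) 1

/-- The range of the parameter: all `β > 1` that exceed the largest digit. -/
def betaRange {q : ℕ} (θ : Fin q → ℕ) : Set ℝ :=
  {β : ℝ | 1 < β ∧ ∀ i, (θ i : ℝ) < β}

end

/-!
All arguments take place on sequences `c` of digit indices. The points of the Cantor set are the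
values of such sequences in base `β` with digits `θ (c i)`, and `α` is determined by values in base
`α` with digits `c i`. A sequence comes from a `β`-expansion exactly when all its tails have values
less than `1` (`admissible`). The basic tool is the comparison of two sequences at their first
difference, where the smaller one loses a whole digit (`value_le_of_lex_lt`); iterating it shows
that a sequence whose tails all lie below a sequence of value at most `1` has tails of value at
most `1` (`value_shift_le_one`). With `ω` the largest sequence, every sequence with all tails
strictly below `ω` is admissible, and all tails of a limit of admissible sequences are at most `ω`.

Existence and uniqueness of `α` come from the value of `ω` being a continuous decreasing function
of the base, monotonicity from comparison in base `α'` (`base_le_base`). Given `α ∈ (q - 1, q]`,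
the quasi-greedy expansion `ω` of `1` in base `α` has the first digit `q - 1` and dominates its
tails; the base `β` in which `θ ∘ ω` has value `1` then has `ω` as its largest sequence
(`exists_isAlpha_eq`).

The dimension is `log α / log β`. For the upper bound, the first deviation from `ω` gives a
recursion for the number of words of length `n`, which is therefore at most `(n + 1) α ^ n`
(`exists_cover`). For the lower bound, the map that re-evaluates a sequence in base `α` instead of
`β` sends a part of the Cantor set onto a set containing `[0, 1)` and is Hölder of every exponent
`t` with `β ^ t < α` (`exists_holder_bound`): by cutting at the first difference of two points, the
estimate reduces to points near `0` (`value_le_rpow`) and points near `1` (`one_sub_value_le`).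

Finally `α`, set to `1` where it is undefined, is a monotone function of `β` with values in `[q -
1, q]` that attains all of `(q - 1, q]`. Hence it is continuous, and so is the dimension.
-/

namespace BetaCantor

/-! ### Values of sequences in a base -/

/-- The sequence `c` with its first `n` terms dropped. -/
def shift {X : Type*} (n : ℕ) (c : ℕ → X) : ℕ → X := fun i => c (i + n)

@[simp] theorem shift_zero {X : Type*} (c : ℕ → X) : shift 0 c = c := rfl

theorem shift_shift {X : Type*} (m n : ℕ) (c : ℕ → X) :
    shift m (shift n c) = shift (m + n) c := by
  funext i; simp [shift, add_assoc]

/-- The value in base `γ` of the sequence of digits `f (c 0), f (c 1), …`. The same sequence `c` of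
digit indices is evaluated with `f = θ` in base `β`, and with `f = Fin.val` in base `α`. -/
noncomputable def value {q : ℕ} (γ : ℝ) (f : Fin q → ℕ) (c : ℕ → Fin q) : ℝ :=
  ∑' i, (f (c i) : ℝ) / γ ^ (i + 1)

variable {q : ℕ}

theorem exists_digit_bound (f : Fin q → ℕ) : ∃ B : ℝ, 0 ≤ B ∧ ∀ i, (f i : ℝ) ≤ B :=
  ⟨∑ i, (f i : ℝ), by positivity, fun i =>
    Finset.single_le_sum (f := fun i => (f i : ℝ)) (fun _ _ => by positivity) (Finset.mem_univ i)⟩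

theorem hasSum_const_div {γ : ℝ} (hγ : 1 < γ) (B : ℝ) :
    HasSum (fun i : ℕ => B / γ ^ (i + 1)) (B / (γ - 1)) := by
  have h0 : 0 < γ := by linarith
  have h1 : γ - 1 ≠ 0 := by linarith
  have h := (hasSum_geometric_of_lt_one (inv_nonneg.2 h0.le)
    (inv_lt_one_of_one_lt₀ hγ)).mul_left (B / γ)
  have e1 : (fun i : ℕ => B / γ ^ (i + 1)) = fun i => B / γ * γ⁻¹ ^ i := by
    funext i; rw [pow_succ, inv_pow]; field_simp
  have e2 : B / γ * (1 - γ⁻¹)⁻¹ = B / (γ - 1) := by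
    have h2 : 1 - γ⁻¹ = (γ - 1) / γ := by field_simp
    rw [h2]; field_simp
  rwa [e1, ← e2]

theorem summable_bound {γ : ℝ} (hγ : 1 < γ) (B : ℝ) : Summable fun i : ℕ => B / γ ^ (i + 1) :=
  (hasSum_const_div hγ B).summable

theorem summable_value {γ : ℝ} (hγ : 1 < γ) (f : Fin q → ℕ) (c : ℕ → Fin q) :
    Summable fun i => (f (c i) : ℝ) / γ ^ (i + 1) := by
  have h0 : 0 < γ := by linarith
  obtain ⟨B, hB, hf⟩ := exists_digit_bound f
  exact Summable.of_nonneg_of_le (fun i => by positivity)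
    (fun i => by gcongr; exact hf _) (summable_bound hγ B)

theorem hasSum_value {γ : ℝ} (hγ : 1 < γ) (f : Fin q → ℕ) (c : ℕ → Fin q) :
    HasSum (fun i => (f (c i) : ℝ) / γ ^ (i + 1)) (value γ f c) :=
  (summable_value hγ f c).hasSum

theorem value_nonneg {γ : ℝ} (hγ : 1 < γ) (f : Fin q → ℕ) (c : ℕ → Fin q) : 0 ≤ value γ f c := by
  have h0 : 0 < γ := by linarith
  exact tsum_nonneg fun i => by positivity

theorem exists_value_bound {γ : ℝ} (hγ : 1 < γ) (f : Fin q → ℕ) :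
    ∃ B : ℝ, 0 ≤ B ∧ ∀ c, value γ f c ≤ B := by
  have h0 : 0 < γ := by linarith
  obtain ⟨B, hB, hf⟩ := exists_digit_bound f
  refine ⟨∑' i : ℕ, B / γ ^ (i + 1), tsum_nonneg fun i => by positivity, fun c => ?_⟩
  exact (summable_value hγ f c).tsum_le_tsum (fun i => by gcongr; exact hf _) (summable_bound hγ B)

theorem value_eq_sum_add {γ : ℝ} (hγ : 1 < γ) (f : Fin q → ℕ) (c : ℕ → Fin q) (n : ℕ) :
    value γ f c = ∑ i ∈ Finset.range n, (f (c i) : ℝ) / γ ^ (i + 1) +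
      value γ f (shift n c) / γ ^ n := by
  have h0 : 0 < γ := by linarith
  rw [value, ← (summable_value hγ f c).sum_add_tsum_nat_add n, value, ← tsum_div_const]
  congr 2
  funext i
  rw [div_div, ← pow_add, shift]
  congr 2; ring

theorem value_eq_of_agree {γ : ℝ} (hγ : 1 < γ) (f : Fin q → ℕ) {c c' : ℕ → Fin q} {n : ℕ}
    (h : ∀ i < n, c i = c' i) :
    value γ f c' - value γ f c = (value γ f (shift n c') - value γ f (shift n c)) / γ ^ n := by
  have hs : ∑ i ∈ Finset.range n, (f (c i) : ℝ) / γ ^ (i + 1) =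
      ∑ i ∈ Finset.range n, (f (c' i) : ℝ) / γ ^ (i + 1) :=
    Finset.sum_congr rfl fun i hi => by rw [h i (Finset.mem_range.1 hi)]
  rw [value_eq_sum_add hγ f c n, value_eq_sum_add hγ f c' n, hs]
  ring

theorem value_shift {γ : ℝ} (hγ : 1 < γ) (f : Fin q → ℕ) (c : ℕ → Fin q) (n : ℕ) :
    value γ f (shift n c) = (f (c n) + value γ f (shift (n + 1) c)) / γ := by
  have := value_eq_sum_add hγ f (shift n c) 1
  rw [this, shift_shift, add_comm 1 n]
  simp [shift, add_div]

theorem value_sub_of_agree {γ : ℝ} (hγ : 1 < γ) (f : Fin q → ℕ) {c c' : ℕ → Fin q} {n : ℕ}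
    (h : ∀ i < n, c i = c' i) :
    value γ f c' - value γ f c = ((f (c' n) : ℝ) - f (c n) + value γ f (shift (n + 1) c') -
      value γ f (shift (n + 1) c)) / γ ^ (n + 1) := by
  have h0 : 0 < γ := by linarith
  rw [value_eq_of_agree hγ f h, value_shift hγ f c, value_shift hγ f c']
  field_simp; ring

theorem value_pos {γ : ℝ} (hγ : 1 < γ) (f : Fin q → ℕ) {c : ℕ → Fin q} {n : ℕ}
    (h : 1 ≤ f (c n)) : 0 < value γ f c := by
  have h0 : 0 < γ := by linarith
  have : (0 : ℝ) < f (c n) := by exact_mod_cast h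
  exact (summable_value hγ f c).tsum_pos (fun i => by positivity) n (by positivity)

/-! ### Lexicographic comparison of sequences and their values -/

theorem toLex_lt_iff {X : Type*} [LT X] {c c' : ℕ → X} :
    toLex c < toLex c' ↔ ∃ n, (∀ i < n, c i = c' i) ∧ c n < c' n := Iff.rfl

theorem toLex_le_iff {X : Type*} [LinearOrder X] {c c' : ℕ → X} :
    toLex c ≤ toLex c' ↔ c = c' ∨ toLex c < toLex c' := by
  exact le_iff_eq_or_lt

theorem comp_lex_lt_iff {X Y : Type*} [LinearOrder X] [LinearOrder Y] {f : X → Y}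
    (hf : StrictMono f) {c c' : ℕ → X} :
    toLex (fun i => f (c i)) < toLex (fun i => f (c' i)) ↔ toLex c < toLex c' := by
  simp only [toLex_lt_iff, hf.injective.eq_iff, hf.lt_iff_lt]

theorem comp_lex_le_iff {X Y : Type*} [LinearOrder X] [LinearOrder Y] {f : X → Y}
    (hf : StrictMono f) {c c' : ℕ → X} :
    toLex (fun i => f (c i)) ≤ toLex (fun i => f (c' i)) ↔ toLex c ≤ toLex c' := by
  exact not_lt.symm.trans ((not_congr (comp_lex_lt_iff hf)).trans not_lt)

theorem apply_zero_le_of_lex_le {X : Type*} [LinearOrder X] {c c' : ℕ → X}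
    (h : toLex c ≤ toLex c') : c 0 ≤ c' 0 := by
  rcases toLex_le_iff.1 h with rfl | ⟨n, hn, hlt⟩
  · exact le_rfl
  · rcases Nat.eq_zero_or_pos n with rfl | h0
    · exact hlt.le
    · exact (hn 0 h0).le

/-- If `c` precedes `c'`, then at the first difference it loses a whole digit, so its value falls
short of that of `c'` by at least the gap between `1` and the value of the remaining tail of `c`. -/
theorem value_le_of_lex_lt {γ : ℝ} (hγ : 1 < γ) {f : Fin q → ℕ} (hf : StrictMono f)
    {c c' : ℕ → Fin q} (h : toLex c < toLex c') :
    ∃ n, value γ f c ≤ value γ f c' - (1 - value γ f (shift (n + 1) c)) / γ ^ (n + 1) := by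
  have h0 : 0 < γ := by linarith
  obtain ⟨n, hn, hlt⟩ := toLex_lt_iff.1 h
  refine ⟨n, ?_⟩
  have h1 := value_sub_of_agree hγ f hn
  have h2 := value_nonneg hγ f (shift (n + 1) c')
  have h3 : (f (c n) : ℝ) + 1 ≤ f (c' n) := by exact_mod_cast hf hlt
  have h4 : (1 - value γ f (shift (n + 1) c)) / γ ^ (n + 1) ≤ value γ f c' - value γ f c := by
    rw [h1]; gcongr; linarith
  linarith

/-- If every tail of `c` lies below some sequence of value at most `1`, then all tails have value at
most `1`: iterating `value_le_of_lex_lt`, a bound `B` for the excess of the tails over `1` improves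
to `B / γ`, then to `B / γ ^ 2`, and so on. -/
theorem value_shift_le_one {γ : ℝ} (hγ : 1 < γ) {f : Fin q → ℕ} (hf : StrictMono f)
    {c : ℕ → Fin q} (h : ∀ n, ∃ c', value γ f c' ≤ 1 ∧ toLex (shift n c) ≤ toLex c') (n : ℕ) :
    value γ f (shift n c) ≤ 1 := by
  have h0 : 0 < γ := by linarith
  obtain ⟨B, hB, hb⟩ := exists_value_bound hγ f
  have key : ∀ N n, value γ f (shift n c) ≤ 1 + B / γ ^ N := by
    intro N
    induction N with
    | zero => intro n; have := hb (shift n c); simp; linarith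
    | succ N ih =>
      intro n
      obtain ⟨c', h1, hle⟩ := h n
      rcases toLex_le_iff.1 hle with heq | hlt
      · rw [heq]; have : 0 ≤ B / γ ^ (N + 1) := by positivity
        linarith
      · obtain ⟨m, hm⟩ := value_le_of_lex_lt hγ hf hlt
        rw [shift_shift] at hm
        have h2 := ih (m + 1 + n)
        have h3 : (value γ f (shift (m + 1 + n) c) - 1) / γ ^ (m + 1) ≤
            B / γ ^ N / γ ^ (m + 1) := by
          gcongr; linarith
        have h4 : B / γ ^ N / γ ^ (m + 1) ≤ B / γ ^ (N + 1) := by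
          rw [div_div, ← pow_add]
          gcongr
          · exact hγ.le
          · omega
        have h5 : (1 - value γ f (shift (m + 1 + n) c)) / γ ^ (m + 1) =
          - ((value γ f (shift (m + 1 + n) c) - 1) / γ ^ (m + 1)) := by ring
        linarith
  have hlim : Filter.Tendsto (fun N : ℕ => 1 + B / γ ^ N) Filter.atTop (𝓝 (1 + 0)) :=
    tendsto_const_nhds.add ((tendsto_pow_atTop_atTop_of_one_lt hγ).const_div_atTop B)
  rw [add_zero] at hlim
  exact ge_of_tendsto' hlim fun N => key N n

theorem value_shift_lt_one {γ : ℝ} (hγ : 1 < γ) {f : Fin q → ℕ} (hf : StrictMono f)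
    {c : ℕ → Fin q} (h : ∀ n, ∃ c', value γ f c' < 1 ∧ toLex (shift n c) ≤ toLex c') (n : ℕ) :
    value γ f (shift n c) < 1 := by
  have h0 : 0 < γ := by linarith
  have hle := value_shift_le_one hγ hf fun n => (h n).imp fun c' hc => ⟨hc.1.le, hc.2⟩
  obtain ⟨c', h1, h2⟩ := h n
  rcases toLex_le_iff.1 h2 with heq | hlt
  · rwa [heq]
  · obtain ⟨m, hm⟩ := value_le_of_lex_lt hγ hf hlt
    rw [shift_shift] at hm
    have : 0 ≤ (1 - value γ f (shift (m + 1 + n) c)) / γ ^ (m + 1) :=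
      div_nonneg (by linarith [hle (m + 1 + n)]) (by positivity)
    linarith

/-- If all tails of `c` have value at most `1`, then every sequence above `c` in the lexicographic
order has at least the value of `c`. -/
theorem value_le_of_lex_le {γ : ℝ} (hγ : 1 < γ) {f : Fin q → ℕ} (hf : StrictMono f)
    {c c' : ℕ → Fin q} (hc : ∀ n, value γ f (shift n c) ≤ 1) (h : toLex c ≤ toLex c') :
    value γ f c ≤ value γ f c' := by
  have h0 : 0 < γ := by linarith
  rcases toLex_le_iff.1 h with rfl | hlt
  · exact le_rfl
  · obtain ⟨m, hm⟩ := value_le_of_lex_lt hγ hf hlt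
    have : 0 ≤ (1 - value γ f (shift (m + 1) c)) / γ ^ (m + 1) :=
      div_nonneg (by linarith [hc (m + 1)]) (by positivity)
    linarith

theorem continuous_value {γ : ℝ} (hγ : 1 < γ) (f : Fin q → ℕ) : Continuous (value γ f) := by
  have h0 : 0 < γ := by linarith
  obtain ⟨B, hB, hf⟩ := exists_digit_bound f
  refine continuous_tsum (u := fun i => B / γ ^ (i + 1)) (fun i => ?_) (summable_bound hγ B) ?_
  · exact (continuous_of_discreteTopology (f := fun j : Fin q => (f j : ℝ) / γ ^ (i + 1))).comp
      (continuous_apply i)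
  · intro i c
    rw [Real.norm_of_nonneg (by positivity)]
    gcongr; exact hf _

/-- In the base `q + 1` the digits less than `q` only give values less than `1`, so that the
lexicographic order of all sequences is the order of their values there. -/
theorem value_lt_one_of_large_base (c : ℕ → Fin q) : value (q + 1) Fin.val c < 1 := by
  have hq : 1 ≤ q := Nat.one_le_iff_ne_zero.2 fun h => by subst h; exact (c 0).elim0
  have hq' : (1 : ℝ) ≤ q := by exact_mod_cast hq
  have hγ : (1 : ℝ) < q + 1 := by linarith
  have h0 : (0 : ℝ) < q + 1 := by linarith
  have hs := hasSum_const_div hγ ((q : ℝ) - 1)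
  rw [add_sub_cancel_right] at hs
  calc value (q + 1) Fin.val c ≤ ((q : ℝ) - 1) / q := by
        refine hasSum_le (fun i => ?_) (hasSum_value hγ _ c) hs
        gcongr
        have : (c i : ℕ) + 1 ≤ q := (c i).2
        have : ((c i : ℕ) : ℝ) + 1 ≤ q := by exact_mod_cast this
        linarith
    _ < 1 := by rw [div_lt_one (by linarith)]; linarith

/-- A nonempty closed set of sequences over a finite alphabet has a lexicographically largest
element: by compactness, one that maximizes the value in the base `q + 1`. -/
theorem exists_lex_max {K : Set (ℕ → Fin q)} (hK : IsClosed K) (hne : K.Nonempty) :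
    ∃ z ∈ K, ∀ c ∈ K, toLex c ≤ toLex z := by
  have hq : 1 ≤ q := Nat.one_le_iff_ne_zero.2 fun h => by subst h; exact (hne.some 0).elim0
  have hq' : (1 : ℝ) ≤ q := by exact_mod_cast hq
  have hγ : (1 : ℝ) < q + 1 := by linarith
  obtain ⟨z, hz, hmax⟩ := hK.isCompact.exists_isMaxOn hne (continuous_value hγ Fin.val).continuousOn
  refine ⟨z, hz, fun c hc => ?_⟩
  by_contra hlt
  obtain ⟨n, hn⟩ := value_le_of_lex_lt hγ Fin.val_strictMono (not_le.1 hlt)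
  have h1 : 0 < (1 - value (q + 1) Fin.val (shift (n + 1) z)) / ((q : ℝ) + 1) ^ (n + 1) :=
    div_pos (by linarith [value_lt_one_of_large_base (shift (n + 1) z)]) (by positivity)
  have h2 := hmax hc
  simp only [mem_ofPred_eq] at h2
  linarith

/-! ### Digit sequences of `β`-expansions -/

/-- An expansion is determined by its remainders: if `r n = (d n + r (n + 1)) / γ` with all
`r n ∈ [0, 1]`, then `d` is a digit sequence of `r 0` in base `γ`. -/
theorem hasSum_of_remainders {γ : ℝ} (hγ : 1 < γ) {d : ℕ → ℕ} {r : ℕ → ℝ}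
    (hr : ∀ n, r n ∈ Icc (0 : ℝ) 1) (h : ∀ n, r n = (d n + r (n + 1)) / γ) :
    HasSum (fun i => (d i : ℝ) / γ ^ (i + 1)) (r 0) := by
  have h0 : 0 < γ := by linarith
  have key : ∀ n, ∑ i ∈ Finset.range n, (d i : ℝ) / γ ^ (i + 1) = r 0 - r n / γ ^ n := by
    intro n
    induction n with
    | zero => simp
    | succ n ih =>
      rw [Finset.sum_range_succ, ih, h n]
      field_simp
      ring
  rw [hasSum_iff_tendsto_nat_of_nonneg (fun i => by positivity)]
  have hlim : Filter.Tendsto (fun n : ℕ => r n / γ ^ n) Filter.atTop (𝓝 0) := by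
    refine squeeze_zero (fun n => div_nonneg (hr n).1 (by positivity))
      (fun n => ?_) ((tendsto_pow_atTop_atTop_of_one_lt hγ).const_div_atTop 1)
    gcongr
    exact (hr n).2
  have := (tendsto_const_nhds (x := r 0)).sub hlim
  rw [sub_zero] at this
  exact this.congr fun n => (key n).symm

theorem iterate_betaT_mem {β x : ℝ} (hx : x ∈ Ico (0 : ℝ) 1) (n : ℕ) :
    (betaT β)^[n] x ∈ Ico (0 : ℝ) 1 := by
  cases n with
  | zero => exact hx
  | succ n =>
    rw [Function.iterate_succ_apply']
    exact ⟨Int.fract_nonneg _, Int.fract_lt_one _⟩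

theorem iterate_betaT_eq {β x : ℝ} (hβ : 1 < β) (hx : x ∈ Ico (0 : ℝ) 1) (n : ℕ) :
    (betaT β)^[n] x = (betaDigit β x n + (betaT β)^[n + 1] x) / β := by
  have h0 : 0 < β := by linarith
  have hn : 0 ≤ β * (betaT β)^[n] x := mul_nonneg h0.le (iterate_betaT_mem hx n).1
  rw [eq_div_iff h0.ne', Function.iterate_succ_apply', betaDigit, betaT,
    natCast_floor_eq_intCast_floor hn, Int.floor_add_fract, mul_comm]

theorem hasSum_betaDigit {β x : ℝ} (hβ : 1 < β) (hx : x ∈ Ico (0 : ℝ) 1) :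
    HasSum (fun i => (betaDigit β x i : ℝ) / β ^ (i + 1)) x :=
  hasSum_of_remainders hβ (r := fun n => (betaT β)^[n] x)
    (fun n => Ico_subset_Icc_self (iterate_betaT_mem hx n)) (iterate_betaT_eq hβ hx)

theorem betaDigit_iterate {β x : ℝ} (m n : ℕ) :
    betaDigit β ((betaT β)^[n] x) m = betaDigit β x (m + n) := by
  rw [betaDigit, betaDigit, Function.iterate_add_apply]

theorem value_shift_of_betaDigit {β x : ℝ} (hβ : 1 < β) (hx : x ∈ Ico (0 : ℝ) 1) {f : Fin q → ℕ}
    {c : ℕ → Fin q} (hc : ∀ n, f (c n) = betaDigit β x n) (n : ℕ) :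
    value β f (shift n c) = (betaT β)^[n] x := by
  refine (hasSum_value hβ f _).unique ?_
  simpa [shift, hc, betaDigit_iterate] using hasSum_betaDigit hβ (iterate_betaT_mem (β := β) hx n)

/-- The index sequences `c` for which `f (c 0), f (c 1), …` is the digit sequence of a point of
`[0, 1)` in base `γ`: this happens exactly when all tails have values less than `1`. -/
def admissible (f : Fin q → ℕ) (γ : ℝ) : Set (ℕ → Fin q) :=
  {c | ∀ n, value γ f (shift n c) < 1}

theorem shift_mem_admissible {f : Fin q → ℕ} {γ : ℝ} {c : ℕ → Fin q} (hc : c ∈ admissible f γ)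
    (n : ℕ) : shift n c ∈ admissible f γ := fun m => by rw [shift_shift]; exact hc _

theorem iterate_betaT_value {β : ℝ} (hβ : 1 < β) {f : Fin q → ℕ} {c : ℕ → Fin q}
    (hc : c ∈ admissible f β) (n : ℕ) :
    (betaT β)^[n] (value β f c) = value β f (shift n c) := by
  have h0 : 0 < β := by linarith
  induction n with
  | zero => rfl
  | succ n ih =>
    rw [Function.iterate_succ_apply', ih, value_shift hβ f c n, betaT, mul_div_cancel₀ _ h0.ne',
      Int.fract_natCast_add]
    exact Int.fract_eq_self.2 ⟨value_nonneg hβ f _, hc _⟩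

theorem betaDigit_value {β : ℝ} (hβ : 1 < β) {f : Fin q → ℕ} {c : ℕ → Fin q}
    (hc : c ∈ admissible f β) (n : ℕ) : betaDigit β (value β f c) n = f (c n) := by
  have h0 : 0 < β := by linarith
  have h1 := value_nonneg hβ f (shift (n + 1) c)
  rw [betaDigit, iterate_betaT_value hβ hc, value_shift hβ f c n, mul_div_cancel₀ _ h0.ne']
  rw [Nat.floor_eq_iff (by positivity)]
  exact ⟨by linarith, by linarith [hc (n + 1)]⟩

theorem value_mem_Ico {β : ℝ} (hβ : 1 < β) {f : Fin q → ℕ} {c : ℕ → Fin q}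
    (hc : c ∈ admissible f β) : value β f c ∈ Ico (0 : ℝ) 1 :=
  ⟨value_nonneg hβ f c, hc 0⟩

theorem exists_admissible_of_betaDigit {β x : ℝ} (hβ : 1 < β) (hx : x ∈ Ico (0 : ℝ) 1)
    {f : Fin q → ℕ} (h : ∀ n, betaDigit β x n ∈ range f) :
    ∃ c ∈ admissible f β, (∀ n, f (c n) = betaDigit β x n) ∧ value β f c = x := by
  choose c hc using h
  refine ⟨c, fun n => ?_, hc, value_shift_of_betaDigit hβ hx hc 0⟩
  rw [value_shift_of_betaDigit hβ hx hc]
  exact (iterate_betaT_mem hx n).2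

theorem digitShift_eq {θ : Fin q → ℕ} {β : ℝ} (hβ : 1 < β) :
    digitShift θ β = (fun (c : ℕ → Fin q) i => θ (c i)) '' closure (admissible θ β) := by
  have hcont : Continuous fun (c : ℕ → Fin q) i => θ (c i) :=
    continuous_pi fun i => continuous_of_discreteTopology.comp (continuous_apply i)
  rw [image_closure_of_isCompact isClosed_closure.isCompact hcont.continuousOn, digitShift]
  congr 1
  ext a
  constructor
  · rintro ⟨x, hx, rfl, h⟩
    obtain ⟨c, hc, hd, -⟩ := exists_admissible_of_betaDigit hβ hx h
    exact ⟨c, hc, funext hd⟩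
  · rintro ⟨c, hc, rfl⟩
    exact ⟨_, value_mem_Ico hβ hc, (funext (betaDigit_value hβ hc)).symm, fun n => ⟨_, rfl⟩⟩

theorem betaCantorSet_eq {θ : Fin q → ℕ} {β : ℝ} (hβ : 1 < β) :
    betaCantorSet θ β = value β θ '' closure (admissible θ β) := by
  rw [image_closure_of_isCompact isClosed_closure.isCompact (continuous_value hβ θ).continuousOn,
    betaCantorSet]
  congr 1
  ext x
  constructor
  · rintro ⟨hx, h⟩
    obtain ⟨c, hc, -, hv⟩ := exists_admissible_of_betaDigit hβ hx h
    exact ⟨c, hc, hv⟩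
  · rintro ⟨c, hc, rfl⟩
    exact ⟨value_mem_Ico hβ hc, fun n => ⟨_, (betaDigit_value hβ hc n).symm⟩⟩

theorem isMaxSeq_iff {θ : Fin q → ℕ} (hθ : StrictMono θ) {β : ℝ} (hβ : 1 < β) {ω : ℕ → Fin q} :
    IsMaxSeq θ β (fun i => θ (ω i)) ↔
      ω ∈ closure (admissible θ β) ∧ ∀ c ∈ closure (admissible θ β), toLex c ≤ toLex ω := by
  rw [IsMaxSeq, digitShift_eq hβ, forall_mem_image]
  refine and_congr ?_ (forall₂_congr fun c _ => comp_lex_le_iff hθ)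
  constructor
  · rintro ⟨c, hc, h⟩
    have : c = ω := funext fun i => hθ.injective (congrFun h i)
    rwa [← this]
  · exact fun h => ⟨ω, h, rfl⟩

/-! ### The closure of the set of admissible sequences -/

theorem mem_closure_iff_agree {X : Type*} [TopologicalSpace X] [DiscreteTopology X]
    {A : Set (ℕ → X)} {c : ℕ → X} :
    c ∈ closure A ↔ ∀ n, ∃ c' ∈ A, ∀ i < n, c' i = c i := by
  rw [(PiNat.isTopologicalBasis_cylinders fun _ : ℕ => X).mem_closure_iff]
  constructor
  · intro h n
    obtain ⟨c', h1, h2⟩ := h _ ⟨c, n, rfl⟩ (PiNat.self_mem_cylinder c n)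
    exact ⟨c', h2, h1⟩
  · rintro h _ ⟨d, n, rfl⟩ hc
    obtain ⟨c', h1, h2⟩ := h n
    exact ⟨c', fun i hi => (h2 i hi).trans (hc i hi), h1⟩

theorem shift_mem_closure {f : Fin q → ℕ} {γ : ℝ} {c : ℕ → Fin q}
    (hc : c ∈ closure (admissible f γ)) (n : ℕ) : shift n c ∈ closure (admissible f γ) :=
  map_mem_closure (f := shift n) (continuous_pi fun i => continuous_apply (i + n)) hc
    fun _ h => shift_mem_admissible h n

theorem value_le_one_of_mem_closure {f : Fin q → ℕ} {γ : ℝ} (hγ : 1 < γ) {c : ℕ → Fin q}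
    (hc : c ∈ closure (admissible f γ)) : value γ f c ≤ 1 :=
  closure_minimal (fun _ h => (h 0).le) (isClosed_le (continuous_value hγ f) continuous_const) hc

/-- A sequence whose tails are all strictly below a limit of admissible sequences is admissible:
an admissible sequence close to the limit still exceeds the tail. -/
theorem mem_admissible_of_lex_lt {f : Fin q → ℕ} (hf : StrictMono f) {γ : ℝ} (hγ : 1 < γ)
    {ω c : ℕ → Fin q} (hω : ω ∈ closure (admissible f γ))
    (hc : ∀ n, toLex (shift n c) < toLex ω) : c ∈ admissible f γ := by
  refine value_shift_lt_one hγ hf fun n => ?_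
  obtain ⟨k, hk, hlt⟩ := toLex_lt_iff.1 (hc n)
  obtain ⟨c', h1, h2⟩ := mem_closure_iff_agree.1 hω (k + 1)
  refine ⟨c', h1 0, le_of_lt (toLex_lt_iff.2 ⟨k, fun i hi => ?_, ?_⟩)⟩
  · rw [hk i hi, h2 i (by omega)]
  · rwa [h2 k (by omega)]

theorem value_anti {f : Fin q → ℕ} {γ γ' : ℝ} (hγ : 1 < γ) (h : γ ≤ γ') (c : ℕ → Fin q) :
    value γ' f c ≤ value γ f c := by
  have h0 : 0 < γ := by linarith
  exact (summable_value (hγ.trans_le h) f c).tsum_le_tsum (fun i => by gcongr)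
    (summable_value hγ f c)

theorem closure_admissible_mono {f : Fin q → ℕ} {γ γ' : ℝ} (hγ : 1 < γ) (h : γ ≤ γ') :
    closure (admissible f γ) ⊆ closure (admissible f γ') :=
  closure_mono fun _ hc n => (value_anti hγ h _).trans_lt (hc n)

/-! ### The base in which a sequence has value one -/

theorem continuousOn_value_base (f : Fin q → ℕ) (c : ℕ → Fin q) :
    ContinuousOn (fun γ => value γ f c) (Ioi 1) := by
  obtain ⟨B, hB, hf⟩ := exists_digit_bound f
  intro γ (hγ : 1 < γ)
  obtain ⟨γ₀, h1, h2⟩ := exists_between hγ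
  have hc : ContinuousOn (fun γ => value γ f c) (Ioi γ₀) := by
    refine continuousOn_tsum (u := fun i => B / γ₀ ^ (i + 1)) (fun i => ?_)
      (summable_bound h1 B) fun i x (hx : γ₀ < x) => ?_
    · refine continuousOn_const.div (continuous_pow _).continuousOn fun x (hx : γ₀ < x) => ?_
      have : 0 < x := by linarith
      positivity
    · have h3 : 0 < γ₀ := by linarith
      have h4 : 0 < x := by linarith
      rw [Real.norm_of_nonneg (by positivity)]
      gcongr; exact hf _
  exact (hc.continuousAt (Ioi_mem_nhds h2)).continuousWithinAt

/-- A sequence whose digits add up to at least `2` has value `1` in some base above `1`, by the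
intermediate value theorem: its value is small in large bases and at least `1` near the base `1`. -/
theorem exists_base_value_eq_one (f : Fin q → ℕ) (c : ℕ → Fin q) (h0 : 1 ≤ f (c 0))
    (h : 2 ≤ f (c 0) ∨ ∃ m, 1 ≤ m ∧ 1 ≤ f (c m)) : ∃ γ, 1 < γ ∧ value γ f c = 1 := by
  obtain ⟨B, hB, hf⟩ := exists_digit_bound f
  have low : ∃ γ, 1 < γ ∧ 1 ≤ value γ f c := by
    rcases h with h | ⟨m, hm, h⟩
    · refine ⟨2, one_lt_two, ?_⟩
      have e := value_shift one_lt_two f c 0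
      have p := value_nonneg one_lt_two f (shift (0 + 1) c)
      have h' : (2 : ℝ) ≤ f (c 0) := by exact_mod_cast h
      rw [shift_zero] at e
      rw [e]; linarith
    · -- in the base `γ` with `γ ^ (m + 1) = 2` both terms contribute at least `1 / 2`
      set γ : ℝ := 2 ^ (1 / ((m : ℝ) + 1)) with hγ
      have hm0 : (0 : ℝ) < (m : ℝ) + 1 := by positivity
      have h1 : 1 < γ := Real.one_lt_rpow one_lt_two (by positivity)
      have hp : γ ^ (m + 1) = 2 := by
        rw [hγ, ← Real.rpow_natCast, ← Real.rpow_mul (by norm_num)]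
        push_cast
        rw [one_div_mul_cancel hm0.ne', Real.rpow_one]
      have hγ0 : 0 < γ := by linarith
      have h2 : γ ≤ 2 := by
        rw [← hp]; exact le_self_pow₀ h1.le (by omega)
      refine ⟨γ, h1, ?_⟩
      have hs := (summable_value h1 f c).sum_le_tsum {0, m} (fun i _ => by positivity)
      rw [Finset.sum_pair (by omega), hp] at hs
      have a1 : (1 : ℝ) ≤ f (c 0) := by exact_mod_cast h0
      have a2 : (1 : ℝ) ≤ f (c m) := by exact_mod_cast h
      have a3 : (1 : ℝ) / 2 ≤ f (c 0) / γ ^ (0 + 1) := by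
        rw [zero_add, pow_one]; gcongr
      have a4 : (1 : ℝ) / 2 ≤ f (c m) / 2 := by gcongr
      rw [value]; linarith
  obtain ⟨γ₁, h1, hv1⟩ := low
  have high : value (max γ₁ (B + 2)) f c ≤ 1 := by
    have hg : 1 < max γ₁ (B + 2) := lt_max_of_lt_left h1
    have hle := hasSum_le (fun i => by gcongr; exact hf _) (hasSum_value hg f c)
      (hasSum_const_div hg B)
    refine hle.trans ?_
    rw [div_le_one (by linarith)]
    linarith [le_max_right γ₁ (B + 2)]
  obtain ⟨γ, hγ, hv⟩ := intermediate_value_Icc' (le_max_left γ₁ (B + 2))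
    ((continuousOn_value_base f c).mono fun x hx => h1.trans_le hx.1) ⟨high, hv1⟩
  exact ⟨γ, h1.trans_le hγ.1, hv⟩

theorem exists_pos_of_hasSum {f : Fin q → ℕ} {ω : ℕ → Fin q} {α : ℝ}
    (h : HasSum (fun i => (f (ω i) : ℝ) / α ^ (i + 1)) 1) : ∃ i, 1 ≤ f (ω i) := by
  by_contra! hn
  have : (fun i => (f (ω i) : ℝ) / α ^ (i + 1)) = fun _ => 0 := by
    funext i; simp [Nat.lt_one_iff.1 (hn i)]
  rw [this] at h
  exact zero_ne_one (hasSum_zero.unique h)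

theorem base_unique {f : Fin q → ℕ} {ω : ℕ → Fin q} {α α' : ℝ} (h0 : 0 < α) (h0' : 0 < α')
    (h : HasSum (fun i => (f (ω i) : ℝ) / α ^ (i + 1)) 1)
    (h' : HasSum (fun i => (f (ω i) : ℝ) / α' ^ (i + 1)) 1) : α = α' := by
  obtain ⟨i, hi⟩ := exists_pos_of_hasSum h
  wlog hlt : α < α' generalizing α α'
  · rcases (not_lt.1 hlt).eq_or_lt with he | hl
    · exact he.symm
    · exact (this h0' h0 h' h hl).symm
  exfalso
  have hi' : (0 : ℝ) < f (ω i) := by exact_mod_cast hi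
  refine lt_irrefl (1 : ℝ) (hasSum_lt (fun j => ?_) (i := i) ?_ h' h)
  · gcongr
  · gcongr

theorem one_le_apply_zero {ω : ℕ → Fin q} (hω : ∀ n, toLex (shift n ω) ≤ toLex ω) {i : ℕ}
    (hi : 1 ≤ (ω i : ℕ)) : 1 ≤ (ω 0 : ℕ) := by
  have h := apply_zero_le_of_lex_le (hω i)
  simp only [shift, zero_add] at h
  exact hi.trans h

theorem one_le_base {ω : ℕ → Fin q} (hω : ∀ n, toLex (shift n ω) ≤ toLex ω) {α : ℝ} (h0 : 0 < α)
    (h : HasSum (fun i => ((ω i : ℕ) : ℝ) / α ^ (i + 1)) 1) : ((ω 0 : ℕ) : ℝ) ≤ α ∧ 1 ≤ α := by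
  obtain ⟨i, hi⟩ := exists_pos_of_hasSum h
  have h1 := one_le_apply_zero hω hi
  have h2 : (1 : ℝ) ≤ (ω 0 : ℕ) := by exact_mod_cast h1
  have h3 := le_hasSum h 0 fun j _ => by positivity
  rw [zero_add, pow_one, div_le_one h0] at h3
  exact ⟨h3, h2.trans h3⟩

/-- In base `1` the value of `ω` can only be `1` if `ω = 1, 0, 0, …`. -/
theorem apply_eq_of_base_one {ω : ℕ → Fin q} (hω : ∀ n, toLex (shift n ω) ≤ toLex ω)
    (h : HasSum (fun i => ((ω i : ℕ) : ℝ) / 1 ^ (i + 1)) 1) (i : ℕ) :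
    (ω i : ℕ) = if i = 0 then 1 else 0 := by
  obtain ⟨j, hj⟩ := exists_pos_of_hasSum h
  have h1 := one_le_apply_zero hω hj
  have h2 : (1 : ℝ) ≤ (ω 0 : ℕ) := by exact_mod_cast h1
  rcases Nat.eq_zero_or_pos i with rfl | hi
  · have h3 := le_hasSum h 0 fun j _ => by positivity
    simp only [one_pow, div_one] at h3
    have : (ω 0 : ℕ) ≤ 1 := by exact_mod_cast h3
    simp; omega
  · have h3 := sum_le_hasSum {0, i} (fun j _ => by positivity) h
    rw [Finset.sum_pair hi.ne] at h3
    simp only [one_pow, div_one] at h3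
    have : (ω 0 : ℕ) + (ω i : ℕ) ≤ 1 := by exact_mod_cast h3
    simp [hi.ne']; omega

theorem exists_base {ω : ℕ → Fin q} (hω : ∀ n, toLex (shift n ω) ≤ toLex ω) {i : ℕ}
    (hi : 1 ≤ (ω i : ℕ)) :
    ∃ α, 0 < α ∧ HasSum (fun i => ((ω i : ℕ) : ℝ) / α ^ (i + 1)) 1 := by
  have h1 := one_le_apply_zero hω hi
  by_cases h : 2 ≤ (ω 0 : ℕ) ∨ ∃ m, 1 ≤ m ∧ 1 ≤ (ω m : ℕ)
  · obtain ⟨γ, hγ, hv⟩ := exists_base_value_eq_one Fin.val ω h1 h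
    exact ⟨γ, by linarith, hv ▸ hasSum_value hγ Fin.val ω⟩
  · push Not at h
    refine ⟨1, one_pos, ?_⟩
    have h2 : (ω 0 : ℕ) = 1 := by omega
    have h3 := hasSum_single (f := fun i => ((ω i : ℕ) : ℝ) / 1 ^ (i + 1)) 0 fun j hj => by
      simp [Nat.lt_one_iff.1 (h.2 j (Nat.one_le_iff_ne_zero.2 hj))]
    simpa [h2] using h3

/-- Larger sequences have value `1` in larger bases: in the base `α'` of the larger sequence
`ω'`, the smaller sequence `ω` has value at most `1` by comparison with `ω'`. -/
theorem base_le_base {ω ω' : ℕ → Fin q} (hω : ∀ n, toLex (shift n ω) ≤ toLex ω)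
    (hω' : ∀ n, toLex (shift n ω') ≤ toLex ω') (hle : toLex ω ≤ toLex ω') {α α' : ℝ}
    (h0 : 0 < α) (h0' : 0 < α') (h : HasSum (fun i => ((ω i : ℕ) : ℝ) / α ^ (i + 1)) 1)
    (h' : HasSum (fun i => ((ω' i : ℕ) : ℝ) / α' ^ (i + 1)) 1) : α ≤ α' := by
  rcases (one_le_base hω' h0' h').2.eq_or_lt with h1 | h1
  · subst h1
    have e := apply_eq_of_base_one hω' h'
    suffices ω = ω' by
      subst this
      exact (base_unique (f := Fin.val) h0 h0' h h').le
    rcases toLex_le_iff.1 hle with heq | ⟨n, hn, hlt⟩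
    · exact heq
    · exfalso
      obtain ⟨i, hi⟩ := exists_pos_of_hasSum h
      have h3 := one_le_apply_zero hω hi
      have h4 : (ω n : ℕ) < (ω' n : ℕ) := hlt
      rw [e n] at h4
      split_ifs at h4 with hn0
      · subst hn0; omega
      · omega
  · by_contra! hlt
    have h2 : 1 < α := h1.trans hlt
    have hv' : value α' Fin.val ω' = 1 := (hasSum_value h1 _ _).unique h'
    have hv : value α' Fin.val ω ≤ 1 := value_shift_le_one h1 Fin.val_strictMono
      (c := ω) (fun n => ⟨ω', hv'.le, (hω n).trans hle⟩) 0
    obtain ⟨i, hi⟩ := exists_pos_of_hasSum h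
    have hi' : (0 : ℝ) < (ω i : ℕ) := by exact_mod_cast hi
    refine hv.not_gt (hasSum_lt (fun j => ?_) (i := i) ?_ h (hasSum_value h1 _ ω))
    · gcongr
    · gcongr

/-! ### The number `α` attached to `β` -/

theorem isAlpha_iff {θ : Fin q → ℕ} (hθ : StrictMono θ) {β α : ℝ} (hβ : 1 < β) :
    IsAlpha θ β α ↔ 0 < α ∧ ∃ ω ∈ closure (admissible θ β),
      (∀ c ∈ closure (admissible θ β), toLex c ≤ toLex ω) ∧
      HasSum (fun i => ((ω i : ℕ) : ℝ) / α ^ (i + 1)) 1 := by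
  simp only [IsAlpha, isMaxSeq_iff hθ hβ, and_assoc]

theorem shift_le_of_max {f : Fin q → ℕ} {γ : ℝ} {ω : ℕ → Fin q}
    (h : ω ∈ closure (admissible f γ))
    (hmax : ∀ c ∈ closure (admissible f γ), toLex c ≤ toLex ω) (n : ℕ) :
    toLex (shift n ω) ≤ toLex ω :=
  hmax _ (shift_mem_closure h n)

theorem exists_isAlpha {θ : Fin q → ℕ} (hθ : StrictMono θ) {β : ℝ} (hβ : 1 < β) {c : ℕ → Fin q}
    (hc : c ∈ closure (admissible θ β)) {i : ℕ} (hi : 1 ≤ (c i : ℕ)) : ∃ α, IsAlpha θ β α := by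
  obtain ⟨ω, hω, hmax⟩ := exists_lex_max isClosed_closure ⟨c, hc⟩
  have h1 := apply_zero_le_of_lex_le (hmax _ (shift_mem_closure hc i))
  simp only [shift, zero_add] at h1
  obtain ⟨α, h0, hs⟩ := exists_base (shift_le_of_max hω hmax) (i := 0) (hi.trans h1)
  exact ⟨α, (isAlpha_iff hθ hβ).2 ⟨h0, ω, hω, hmax, hs⟩⟩

theorem isAlpha_unique {θ : Fin q → ℕ} (hθ : StrictMono θ) {β α α' : ℝ} (hβ : 1 < β)
    (h : IsAlpha θ β α) (h' : IsAlpha θ β α') : α = α' := by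
  obtain ⟨h0, ω, hω, hmax, hs⟩ := (isAlpha_iff hθ hβ).1 h
  obtain ⟨h0', ω', hω', hmax', hs'⟩ := (isAlpha_iff hθ hβ).1 h'
  have : ω = ω' := toLex_inj.1 (le_antisymm (hmax' _ hω) (hmax _ hω'))
  subst this
  exact base_unique (f := Fin.val) h0 h0' hs hs'

theorem isAlpha_le {θ : Fin q → ℕ} (hθ : StrictMono θ) {β β' α α' : ℝ} (hβ : 1 < β)
    (hle : β ≤ β') (h : IsAlpha θ β α) (h' : IsAlpha θ β' α') : α ≤ α' := by
  obtain ⟨h0, ω, hω, hmax, hs⟩ := (isAlpha_iff hθ hβ).1 h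
  obtain ⟨h0', ω', hω', hmax', hs'⟩ := (isAlpha_iff hθ (hβ.trans_le hle)).1 h'
  exact base_le_base (shift_le_of_max hω hmax) (shift_le_of_max hω' hmax')
    (hmax' _ (closure_admissible_mono hβ hle hω)) h0 h0' hs hs'

theorem one_le_of_isAlpha {θ : Fin q → ℕ} (hθ : StrictMono θ) {β α : ℝ} (hβ : 1 < β)
    (h : IsAlpha θ β α) : 1 ≤ α := by
  obtain ⟨h0, ω, hω, hmax, hs⟩ := (isAlpha_iff hθ hβ).1 h
  exact (one_le_base (shift_le_of_max hω hmax) h0 hs).2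

/-- `α` is still defined when `β` grows. -/
theorem exists_isAlpha_mono {θ : Fin q → ℕ} (hθ : StrictMono θ) {β β' α : ℝ} (hβ : 1 < β)
    (hle : β ≤ β') (h : IsAlpha θ β α) : ∃ α', IsAlpha θ β' α' := by
  obtain ⟨h0, ω, hω, hmax, hs⟩ := (isAlpha_iff hθ hβ).1 h
  obtain ⟨i, hi⟩ := exists_pos_of_hasSum hs
  exact exists_isAlpha hθ (hβ.trans_le hle) (closure_admissible_mono hβ hle hω) hi

theorem hasSum_const_base {m : ℕ} (hm : 1 ≤ m) :
    HasSum (fun i : ℕ => (m : ℝ) / ((m : ℝ) + 1) ^ (i + 1)) 1 := by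
  have hm' : (1 : ℝ) ≤ m := by exact_mod_cast hm
  have h := hasSum_const_div (γ := (m : ℝ) + 1) (by linarith) m
  rwa [add_sub_cancel_right, div_self (by linarith)] at h

theorem isAlpha_le_card {θ : Fin q → ℕ} (hθ : StrictMono θ) {β α : ℝ} (hβ : 1 < β)
    (h : IsAlpha θ β α) : α ≤ q := by
  obtain ⟨h0, ω, hω, hmax, hs⟩ := (isAlpha_iff hθ hβ).1 h
  obtain ⟨i, hi⟩ := exists_pos_of_hasSum hs
  have hq : (ω i : ℕ) < q := (ω i).2
  have hs' := hasSum_const_base (m := q - 1) (by omega)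
  rw [Nat.cast_sub (by omega), Nat.cast_one, sub_add_cancel] at hs'
  refine base_le_base (ω' := fun _ => ⟨q - 1, by omega⟩) (shift_le_of_max hω hmax)
    (fun n => le_rfl) (Pi.toLex_monotone fun j => Fin.le_def.2 ?_) h0
    (by exact_mod_cast (by omega : 0 < q)) hs ?_
  · have := (ω j).2
    simp only; omega
  · simpa only [Nat.cast_sub (by omega : 1 ≤ q), Nat.cast_one] using hs'

/-- The constant sequence of the second largest digit is always admissible. -/
theorem const_mem_admissible {θ : Fin q → ℕ} (hθ : StrictMono θ) {β : ℝ} (hβ : β ∈ betaRange θ)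
    (hq : 2 ≤ q) : (fun _ => ⟨q - 2, by omega⟩ : ℕ → Fin q) ∈ admissible θ β := by
  intro n
  have h1 : θ ⟨q - 2, by omega⟩ < θ ⟨q - 1, by omega⟩ := hθ (Fin.lt_def.2 (by simp only; omega))
  have h2 : (θ ⟨q - 2, by omega⟩ : ℝ) + 1 ≤ θ ⟨q - 1, by omega⟩ := by exact_mod_cast h1
  have h3 := hβ.2 ⟨q - 1, by omega⟩
  have h4 := hβ.1
  have e : value β θ (shift n fun _ => ⟨q - 2, by omega⟩) =
      (θ ⟨q - 2, by omega⟩ : ℝ) / (β - 1) :=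
    (hasSum_value h4 θ _).unique (hasSum_const_div h4 _)
  rw [e, div_lt_one (by linarith)]
  linarith

theorem card_sub_one_le_of_isAlpha {θ : Fin q → ℕ} (hθ : StrictMono θ) {β α : ℝ}
    (hβ : β ∈ betaRange θ) (h : IsAlpha θ β α) : (q : ℝ) - 1 ≤ α := by
  obtain ⟨h0, ω, hω, hmax, hs⟩ := (isAlpha_iff hθ hβ.1).1 h
  have h1 := one_le_of_isAlpha hθ hβ.1 h
  by_cases hq : q ≤ 2
  · have : (q : ℝ) ≤ 2 := by exact_mod_cast hq
    linarith
  · have hs' := hasSum_const_base (m := q - 2) (by omega)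
    have e : ((q - 2 : ℕ) : ℝ) + 1 = q - 1 := by
      rw [Nat.cast_sub (by omega)]; push_cast; ring
    rw [e] at hs'
    refine base_le_base (ω := fun _ => ⟨q - 2, by omega⟩) (fun n => le_rfl)
      (shift_le_of_max hω hmax) (hmax _ (subset_closure (const_mem_admissible hθ hβ (by omega))))
      ?_ h0 hs' hs
    rw [← e]; positivity

theorem exists_isAlpha_of_three_le {θ : Fin q → ℕ} (hθ : StrictMono θ) {β : ℝ}
    (hβ : β ∈ betaRange θ) (hq : 3 ≤ q) : ∃ α, IsAlpha θ β α :=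
  exists_isAlpha hθ hβ.1 (subset_closure (const_mem_admissible hθ hβ (by omega))) (i := 0)
    (by simp only; omega)

theorem exists_isAlpha_of_nontrivial {θ : Fin q → ℕ} (hθ : StrictMono θ) {β : ℝ} (hβ : 1 < β)
    (h : (betaCantorSet θ β).Nontrivial) : ∃ α, IsAlpha θ β α := by
  rw [betaCantorSet_eq hβ] at h
  obtain ⟨_, ⟨c, hc, rfl⟩, _, ⟨c', hc', rfl⟩, hne⟩ := h
  have : c ≠ c' := fun h => hne (by rw [h])
  obtain ⟨i, hi⟩ := Function.ne_iff.1 this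
  rcases Nat.eq_zero_or_pos (c i : ℕ) with h1 | h1
  · refine exists_isAlpha hθ hβ hc' (i := i) ?_
    by_contra h2
    exact hi (Fin.ext (by omega))
  · exact exists_isAlpha hθ hβ hc h1

/-! ### Every number in `(q - 1, q]` is attained -/

/-- The quasi-greedy expansion of `1` in base `α`: the digit sequence all of whose remainders lie in
`(0, 1]`. -/
theorem exists_quasiGreedy {α : ℝ} (h1 : 1 < α) (hα : α ≤ q) :
    ∃ ω : ℕ → Fin q, value α Fin.val ω = 1 ∧
      ∀ n, 0 < value α Fin.val (shift n ω) ∧ value α Fin.val (shift n ω) ≤ 1 := by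
  have h0 : 0 < α := by linarith
  have step : ∀ x : Ioc (0 : ℝ) 1, ∃ d : Fin q, ∃ y : Ioc (0 : ℝ) 1,
      (x : ℝ) = (((d : ℕ) : ℝ) + y) / α := by
    rintro ⟨x, hx0, hx1⟩
    have hp : 0 < α * x := mul_pos h0 hx0
    have hc : 0 < ⌈α * x⌉₊ := Nat.ceil_pos.2 hp
    have hle : ⌈α * x⌉₊ ≤ q := Nat.ceil_le.2 ((mul_le_of_le_one_right h0.le hx1).trans hα)
    have hd : ((⌈α * x⌉₊ - 1 : ℕ) : ℝ) = ⌈α * x⌉₊ - 1 := by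
      rw [Nat.cast_sub hc, Nat.cast_one]
    refine ⟨⟨⌈α * x⌉₊ - 1, by omega⟩, ⟨α * x - (⌈α * x⌉₊ - 1 : ℕ), ?_, ?_⟩, ?_⟩
    · rw [hd]; linarith [Nat.ceil_lt_add_one hp.le]
    · rw [hd]; linarith [Nat.le_ceil (α * x)]
    · simp only; field_simp; ring
  choose d y hdy using step
  let r : ℕ → Ioc (0 : ℝ) 1 := fun n => y^[n] ⟨1, one_pos, le_rfl⟩
  have hr : ∀ n, (r n : ℝ) = (((d (r n) : ℕ) : ℝ) + r (n + 1)) / α := by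
    intro n
    have : r (n + 1) = y (r n) := Function.iterate_succ_apply' _ _ _
    rw [this]; exact hdy _
  have hv : ∀ n, value α Fin.val (shift n fun i => d (r i)) = r n := by
    intro n
    refine (hasSum_value h1 _ _).unique ?_
    have := hasSum_of_remainders h1 (d := fun i => (d (r (i + n)) : ℕ)) (r := fun i => r (i + n))
      (fun i => Ioc_subset_Icc_self (r _).2) fun i => by
        rw [hr (i + n)]; congr 4; omega
    simp only [zero_add] at this
    exact this
  refine ⟨fun i => d (r i), hv 0, fun n => ?_⟩
  rw [hv n]; exact (r n).2

/-- A sequence `ω` of value `1` whose tails have values in `(0, 1]` dominates its tails: a larger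
tail would exceed `ω` by a whole digit and a positive remainder. -/
theorem shift_le_of_quasiGreedy {α : ℝ} (h1 : 1 < α) {ω : ℕ → Fin q}
    (hv : value α Fin.val ω = 1)
    (hω : ∀ n, 0 < value α Fin.val (shift n ω) ∧ value α Fin.val (shift n ω) ≤ 1) (n : ℕ) :
    toLex (shift n ω) ≤ toLex ω := by
  have h0 : 0 < α := by linarith
  by_contra hlt
  obtain ⟨k, hk, hkl⟩ := toLex_lt_iff.1 (not_le.1 hlt)
  have e := value_sub_of_agree h1 Fin.val hk
  have h2 : ((ω k : ℕ) : ℝ) + 1 ≤ ((shift n ω k : Fin q) : ℕ) := by exact_mod_cast Fin.lt_def.1 hkl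
  have h3 := hω (k + 1)
  have h4 := hω (k + 1 + n)
  have h5 : 0 < value α Fin.val (shift n ω) - value α Fin.val ω := by
    rw [e, shift_shift]
    exact div_pos (by linarith) (by positivity)
  linarith [(hω n).2]

/-- A sequence of value `1` that dominates its tails and does not end in zeros is the largest
element of the closure of the admissible sequences: its truncations are admissible. -/
theorem isMax_of_value_eq_one {θ : Fin q → ℕ} (hθ : StrictMono θ) {β : ℝ} (hβ : 1 < β)
    {ω : ℕ → Fin q} (hv : value β θ ω = 1) (hω : ∀ n, toLex (shift n ω) ≤ toLex ω)
    (hnz : ∀ n, ∃ i, n ≤ i ∧ 1 ≤ (ω i : ℕ)) :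
    ω ∈ closure (admissible θ β) ∧ ∀ c ∈ closure (admissible θ β), toLex c ≤ toLex ω := by
  have h0 : 0 < β := by linarith
  have hle := value_shift_le_one hβ hθ fun n => ⟨ω, hv.le, hω n⟩
  constructor
  · refine mem_closure_iff_agree.2 fun N => ?_
    have hq : 0 < q := (ω 0).pos
    refine ⟨fun i => if i < N then ω i else ⟨0, hq⟩, fun n => ?_, fun i hi => if_pos hi⟩
    refine lt_of_lt_of_le ?_ (hle n)
    have hterm : ∀ i, (if i < N then ω i else ⟨0, hq⟩ : Fin q) ≤ ω i := by
      intro i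
      split_ifs
      · exact le_rfl
      · exact Fin.le_def.2 (Nat.zero_le _)
    obtain ⟨i, hi, hpos⟩ := hnz (max N n)
    refine (summable_value hβ θ _).tsum_lt_tsum (i := i - n) (fun j => ?_) ?_
      (summable_value hβ θ _)
    · have := hθ.monotone (hterm (j + n))
      simp only [shift]
      gcongr
    · have hlt : θ ⟨0, hq⟩ < θ (ω i) := hθ (Fin.lt_def.2 hpos)
      have hin : i - n + n = i := by omega
      simp only [shift, hin]
      rw [if_neg (by omega)]
      gcongr
  · intro c hc
    by_contra hlt
    obtain ⟨k, hk, hkl⟩ := toLex_lt_iff.1 (not_le.1 hlt)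
    obtain ⟨c', h1, h2⟩ := mem_closure_iff_agree.1 hc (k + 1)
    have h3 : toLex ω < toLex c' := toLex_lt_iff.2
      ⟨k, fun i hi => (hk i hi).trans (h2 i (by omega)).symm, by rwa [h2 k (by omega)]⟩
    have h4 := value_le_of_lex_le hβ hθ hle h3.le
    have h5 := h1 0
    rw [shift_zero] at h5
    linarith

theorem exists_isAlpha_eq {θ : Fin q → ℕ} (hθ : StrictMono θ) (hq : 2 ≤ q) {α : ℝ}
    (hα : α ∈ Ioc ((q : ℝ) - 1) q) : ∃ β ∈ betaRange θ, IsAlpha θ β α := by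
  have hq' : (2 : ℝ) ≤ q := by exact_mod_cast hq
  have h1 : 1 < α := by linarith [hα.1]
  have h0 : 0 < α := by linarith
  obtain ⟨ω, hv, hω⟩ := exists_quasiGreedy h1 hα.2
  have hdom := shift_le_of_quasiGreedy h1 hv hω
  have hnz : ∀ n, ∃ i, n ≤ i ∧ 1 ≤ (ω i : ℕ) := by
    intro n
    by_contra! hn
    have : value α Fin.val (shift n ω) = 0 := by
      have e : ∀ i, (((shift n ω i : Fin q) : ℕ) : ℝ) / α ^ (i + 1) = 0 := fun i => by
        simp [shift, Nat.lt_one_iff.1 (hn (i + n) (by omega))]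
      rw [value, tsum_congr e, tsum_zero]
    linarith [(hω n).1]
  -- the first digit is the largest one because `α > q - 1`
  have hω0 : q - 1 ≤ (ω 0 : ℕ) := by
    have e := value_shift h1 Fin.val ω 0
    rw [shift_zero, hv, eq_div_iff h0.ne'] at e
    have h2 := (hω (0 + 1)).2
    have h3 : (q : ℝ) < (ω 0 : ℕ) + 2 := by linarith [hα.1]
    have h4 : q < (ω 0 : ℕ) + 2 := by exact_mod_cast h3
    omega
  have hpos : ∀ {j : Fin q}, 1 ≤ (j : ℕ) → 1 ≤ θ j := fun {j} hj =>
    (Nat.zero_le _).trans_lt (hθ (Fin.lt_def.2 hj : (⟨0, by omega⟩ : Fin q) < j))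
  obtain ⟨m, hm, hm1⟩ := hnz 1
  obtain ⟨β, hβ, hvβ⟩ := exists_base_value_eq_one θ ω (hpos (by omega)) (.inr ⟨m, hm, hpos hm1⟩)
  have hβ0 : 0 < β := by linarith
  refine ⟨β, ⟨hβ, fun i => ?_⟩, (isAlpha_iff hθ hβ).2 ?_⟩
  · have h2 : θ i ≤ θ (ω 0) := hθ.monotone (Fin.le_def.2 (by have := i.2; omega))
    have h3 : (θ i : ℝ) ≤ θ (ω 0) := by exact_mod_cast h2
    have e := value_shift hβ θ ω 0
    rw [shift_zero, hvβ, eq_div_iff hβ0.ne'] at e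
    have h4 : 0 < value β θ (shift (0 + 1) ω) := value_pos hβ θ (n := m - 1) (by
      rw [shift, zero_add, Nat.sub_add_cancel hm]; exact hpos hm1)
    linarith
  · obtain ⟨h2, h3⟩ := isMax_of_value_eq_one hθ hβ hvβ hdom hnz
    exact ⟨h0, ω, h2, h3, hv ▸ hasSum_value h1 Fin.val ω⟩

/-! ### Continuity of `α` -/

open Classical in
/-- The number `α` attached to `β`, set to `1` where it is undefined (so that its logarithm is the
entropy `0` there). -/
noncomputable def alpha (θ : Fin q → ℕ) (β : ℝ) : ℝ :=
  if h : ∃ α, IsAlpha θ β α then h.choose else 1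

theorem alpha_eq {θ : Fin q → ℕ} (hθ : StrictMono θ) {β α : ℝ} (hβ : 1 < β)
    (h : IsAlpha θ β α) : alpha θ β = α := by
  have h' : ∃ α, IsAlpha θ β α := ⟨α, h⟩
  rw [alpha, dif_pos h']
  exact isAlpha_unique hθ hβ h'.choose_spec h

theorem alpha_eq_one {θ : Fin q → ℕ} {β : ℝ} (h : ¬ ∃ α, IsAlpha θ β α) : alpha θ β = 1 :=
  dif_neg h

theorem alpha_mem_Icc {θ : Fin q → ℕ} (hθ : StrictMono θ) (hq : 2 ≤ q) {β : ℝ}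
    (hβ : β ∈ betaRange θ) : alpha θ β ∈ Icc ((q : ℝ) - 1) q := by
  by_cases h : ∃ α, IsAlpha θ β α
  · obtain ⟨α, h⟩ := h
    rw [alpha_eq hθ hβ.1 h]
    exact ⟨card_sub_one_le_of_isAlpha hθ hβ h, isAlpha_le_card hθ hβ.1 h⟩
  · have h2 : q = 2 := by
      by_contra hne
      exact h (exists_isAlpha_of_three_le hθ hβ (by omega))
    subst h2
    rw [alpha_eq_one h]
    norm_num

theorem alpha_monotoneOn {θ : Fin q → ℕ} (hθ : StrictMono θ) :
    MonotoneOn (alpha θ) (betaRange θ) := by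
  intro β hβ β' hβ' hle
  by_cases h : ∃ α, IsAlpha θ β α
  · obtain ⟨α, h⟩ := h
    obtain ⟨α', h'⟩ := exists_isAlpha_mono hθ hβ.1 hle h
    rw [alpha_eq hθ hβ.1 h, alpha_eq hθ hβ'.1 h']
    exact isAlpha_le hθ hβ.1 hle h h'
  · rw [alpha_eq_one h]
    by_cases h' : ∃ α, IsAlpha θ β' α
    · obtain ⟨α', h'⟩ := h'
      rw [alpha_eq hθ hβ'.1 h']
      exact one_le_of_isAlpha hθ hβ'.1 h'
    · rw [alpha_eq_one h']

/-- `α` is a monotone function of `β` with values in `[q - 1, q]` that attains every value in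
`(q - 1, q]`; such a function has no jumps. -/
theorem continuousOn_alpha {θ : Fin q → ℕ} (hθ : StrictMono θ) (hq : 2 ≤ q) :
    ContinuousOn (alpha θ) (betaRange θ) := by
  have hoc : (betaRange θ).OrdConnected :=
    ⟨fun x hx y _ z hz => ⟨hx.1.trans_le hz.1, fun i => (hx.2 i).trans_le hz.1⟩⟩
  let F : betaRange θ → Icc ((q : ℝ) - 1) q := fun β => ⟨alpha θ β, alpha_mem_Icc hθ hq β.2⟩
  have hmono : Monotone F := fun β β' h => alpha_monotoneOn hθ β.2 β'.2 h
  have hdense : DenseRange F := by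
    have hsub : Ioi (⟨(q : ℝ) - 1, by simp⟩ : Icc ((q : ℝ) - 1) q) ⊆ range F := by
      rintro ⟨a, ha⟩ hlt
      obtain ⟨β, hβ, h⟩ := exists_isAlpha_eq hθ hq (α := a) ⟨hlt, ha.2⟩
      exact ⟨⟨β, hβ⟩, Subtype.ext (alpha_eq hθ hβ.1 h)⟩
    refine Dense.mono hsub fun x => ?_
    have hne : (Ioi (⟨(q : ℝ) - 1, by simp⟩ : Icc ((q : ℝ) - 1) q)).Nonempty :=
      ⟨⟨q, by simp⟩, by rw [mem_Ioi, Subtype.mk_lt_mk]; linarith⟩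
    rw [closure_Ioi' hne]
    exact x.2.1
  have hcont : Continuous F := hmono.continuous_of_denseRange hdense
  exact continuousOn_iff_continuous_domRestrict.2 (continuous_subtype_val.comp hcont)

/-! ### Upper bound for the dimension -/

/-- The closure of the admissible sequences has at most `(n + 1) α ^ n` words of length `n`: a word
is either the initial word of the largest sequence `ω`, or it first deviates from `ω` at some index
`k < n`, by one of `ω k` smaller digits, and continues with an arbitrary word of length
`n - 1 - k`. The points of the finite set stand for the words. -/
theorem exists_cover {θ : Fin q → ℕ} {α β : ℝ} (hβ : 1 < β) (hα : 1 ≤ α)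
    {ω : ℕ → Fin q} (hmax : ∀ c ∈ closure (admissible θ β), toLex c ≤ toLex ω)
    (hs : HasSum (fun i => ((ω i : ℕ) : ℝ) / α ^ (i + 1)) 1) (n : ℕ) :
    ∃ P : Finset ℝ, (P.card : ℝ) ≤ (n + 1) * α ^ n ∧
      ∀ c ∈ closure (admissible θ β), ∃ p ∈ P, value β θ c ∈ Icc p (p + 1 / β ^ n) := by
  have hβ0 : 0 < β := by linarith
  have hα0 : 0 < α := by linarith
  induction n using Nat.strong_induction_on with
  | _ n ih =>
  choose! P hcard hP using ih
  let S : ℕ → ℝ := fun k => ∑ i ∈ Finset.range k, (θ (ω i) : ℝ) / β ^ (i + 1)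
  refine ⟨insert (S n) ((Finset.range n).biUnion fun k => (Finset.Iio (ω k)).biUnion fun j =>
    (P (n - 1 - k)).image fun p => S k + (θ j + p) / β ^ (k + 1)), ?_, ?_⟩
  · have h1 : ∀ k ∈ Finset.range n, (((Finset.Iio (ω k)).biUnion fun j =>
        (P (n - 1 - k)).image fun p => S k + (θ j + p) / β ^ (k + 1)).card : ℝ) ≤
        n * α ^ n * (((ω k : ℕ) : ℝ) / α ^ (k + 1)) := by
      intro k hk
      rw [Finset.mem_range] at hk
      have hle : ((Finset.Iio (ω k)).biUnion fun j =>
          (P (n - 1 - k)).image fun p => S k + (θ j + p) / β ^ (k + 1)).card ≤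
          (ω k : ℕ) * (P (n - 1 - k)).card := by
        refine (Finset.card_biUnion_le_card_mul _ _ _ fun j _ => Finset.card_image_le).trans ?_
        rw [Fin.card_Iio]
      have hpow : α ^ n = α ^ (n - 1 - k) * α ^ (k + 1) := by
        rw [← pow_add]; congr 1; omega
      have hn : ((n - 1 - k : ℕ) : ℝ) + 1 ≤ n := by
        exact_mod_cast (by omega : n - 1 - k + 1 ≤ n)
      calc (_ : ℝ) ≤ (ω k : ℕ) * (P (n - 1 - k)).card := by exact_mod_cast hle
        _ ≤ (ω k : ℕ) * (n * α ^ (n - 1 - k)) := by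
          refine mul_le_mul_of_nonneg_left ?_ (by positivity)
          refine (hcard _ (by omega)).trans ?_
          gcongr
        _ = _ := by rw [hpow]; field_simp
    have h2 : ∑ k ∈ Finset.range n, ((ω k : ℕ) : ℝ) / α ^ (k + 1) ≤ 1 :=
      sum_le_hasSum _ (fun i _ => by positivity) hs
    have h3 : (1 : ℝ) ≤ α ^ n := one_le_pow₀ hα
    calc (_ : ℝ) ≤ ∑ k ∈ Finset.range n, ((((Finset.Iio (ω k)).biUnion fun j =>
        (P (n - 1 - k)).image fun p => S k + (θ j + p) / β ^ (k + 1)).card : ℕ) : ℝ) + 1 := by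
          exact_mod_cast (Finset.card_insert_le _ _).trans
            (Nat.add_le_add_right Finset.card_biUnion_le 1)
      _ ≤ ∑ k ∈ Finset.range n, n * α ^ n * (((ω k : ℕ) : ℝ) / α ^ (k + 1)) + 1 := by
          gcongr with k hk; exact h1 k hk
      _ ≤ n * α ^ n * 1 + 1 := by rw [← Finset.mul_sum]; gcongr
      _ ≤ (n + 1) * α ^ n := by linarith
  · intro c hc
    have hsum : ∀ k, (∀ i < k, c i = ω i) →
        value β θ c = S k + value β θ (shift k c) / β ^ k := by
      intro k hk
      rw [value_eq_sum_add hβ θ c k]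
      congr 1
      exact Finset.sum_congr rfl fun i hi => by rw [hk i (Finset.mem_range.1 hi)]
    by_cases hn : ∀ i < n, c i = ω i
    · refine ⟨_, Finset.mem_insert_self _ _, ?_⟩
      have h1 := value_le_one_of_mem_closure hβ (shift_mem_closure hc n)
      have h2 := value_nonneg hβ θ (shift n c)
      rw [hsum n hn]
      constructor
      · have : 0 ≤ value β θ (shift n c) / β ^ n := by positivity
        linarith
      · gcongr
    · obtain ⟨k, hk, hlt⟩ : toLex c < toLex ω :=
        lt_of_le_of_ne (hmax c hc) fun h => hn fun i _ => congrFun (toLex_inj.1 h) i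
      have hkn : k < n := by
        by_contra hnk
        exact hn fun i hi => hk i (by omega)
      obtain ⟨p, hp, h1, h2⟩ := hP (n - 1 - k) (by omega) _ (shift_mem_closure hc (k + 1))
      refine ⟨S k + (θ (c k) + p) / β ^ (k + 1), Finset.mem_insert_of_mem ?_, ?_⟩
      · exact Finset.mem_biUnion.2 ⟨k, Finset.mem_range.2 hkn, Finset.mem_biUnion.2
          ⟨c k, Finset.mem_Iio.2 hlt, Finset.mem_image_of_mem _ hp⟩⟩
      · have e : value β θ c =
            S k + (θ (c k) + value β θ (shift (k + 1) c)) / β ^ (k + 1) := by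
          rw [hsum k hk, value_shift hβ θ c k, div_div, ← pow_succ']
        have hpow : 1 / β ^ n = 1 / β ^ (n - 1 - k) / β ^ (k + 1) := by
          rw [div_div, ← pow_add]; congr 2; omega
        rw [e, hpow, add_assoc, ← add_div, add_assoc]
        constructor <;> gcongr

open MeasureTheory in
theorem dimH_le_of_lt_rpow {θ : Fin q → ℕ} {α β : ℝ} (hβ : 1 < β) (hα : 1 ≤ α)
    {ω : ℕ → Fin q} (hmax : ∀ c ∈ closure (admissible θ β), toLex c ≤ toLex ω)
    (hs : HasSum (fun i => ((ω i : ℕ) : ℝ) / α ^ (i + 1)) 1) {d : NNReal}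
    (hd : α < β ^ (d : ℝ)) : dimH (betaCantorSet θ β) ≤ d := by
  have hβ0 : 0 < β := by linarith
  have hα0 : 0 < α := by linarith
  have hβd : 0 < β ^ (d : ℝ) := by positivity
  choose P hcard hP using exists_cover hβ hα hmax hs
  refine dimH_le_of_hausdorffMeasure_ne_top (ne_top_of_le_ne_top ENNReal.zero_ne_top ?_)
  have hr : Filter.Tendsto (fun n : ℕ => ENNReal.ofReal (1 / β ^ n)) Filter.atTop (𝓝 0) := by
    rw [← ENNReal.ofReal_zero]
    exact ENNReal.tendsto_ofReal ((tendsto_pow_atTop_atTop_of_one_lt hβ).const_div_atTop 1)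
  refine (Measure.hausdorffMeasure_le_liminf_sum (d : ℝ) _ _ hr
    (fun n (p : P n) => Icc (p : ℝ) (p + 1 / β ^ n)) (Filter.Eventually.of_forall fun n p => ?_)
    (Filter.Eventually.of_forall fun n => ?_)).trans ?_
  · rw [Real.ediam_Icc, add_sub_cancel_left]
  · rw [betaCantorSet_eq hβ]
    rintro _ ⟨c, hc, rfl⟩
    obtain ⟨p, hp, h⟩ := hP n c hc
    exact mem_iUnion.2 ⟨⟨p, hp⟩, h⟩
  · refine le_of_eq (Filter.Tendsto.liminf_eq ?_)
    have hρ0 : 0 ≤ α / β ^ (d : ℝ) := by positivity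
    have hρ : α / β ^ (d : ℝ) < 1 := (div_lt_one hβd).2 hd
    have hlim : Filter.Tendsto (fun n : ℕ => ENNReal.ofReal (((n : ℝ) + 1) *
        (α / β ^ (d : ℝ)) ^ n)) Filter.atTop (𝓝 0) := by
      rw [← ENNReal.ofReal_zero]
      refine ENNReal.tendsto_ofReal ?_
      have := (tendsto_self_mul_const_pow_of_lt_one hρ0 hρ).add
        (tendsto_pow_atTop_nhds_zero_of_lt_one hρ0 hρ)
      simpa [add_mul] using this
    refine tendsto_of_tendsto_of_tendsto_of_le_of_le tendsto_const_nhds hlim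
      (fun n => zero_le) fun n => ?_
    simp only [Real.ediam_Icc, add_sub_cancel_left, Finset.sum_const, Finset.card_univ,
      Fintype.card_coe, nsmul_eq_mul]
    rw [ENNReal.ofReal_rpow_of_nonneg (by positivity) d.coe_nonneg, ← ENNReal.ofReal_natCast,
      ← ENNReal.ofReal_mul (by positivity)]
    refine ENNReal.ofReal_le_ofReal ?_
    have e : (1 / β ^ n) ^ (d : ℝ) = 1 / (β ^ (d : ℝ)) ^ n := by
      rw [Real.div_rpow zero_le_one (by positivity), Real.one_rpow, ← Real.rpow_natCast,
        ← Real.rpow_natCast, ← Real.rpow_mul hβ0.le, ← Real.rpow_mul hβ0.le, mul_comm]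
    rw [e, div_pow, mul_one_div, ← mul_div_assoc]
    gcongr
    exact hcard n

/-! ### Lower bound for the dimension -/

theorem rpow_div_pow {β t x : ℝ} (hβ : 0 < β) (hx : 0 ≤ x) (n : ℕ) :
    (x / β ^ n) ^ t = x ^ t / (β ^ t) ^ n := by
  rw [Real.div_rpow hx (by positivity), ← Real.rpow_natCast, ← Real.rpow_natCast,
    ← Real.rpow_mul hβ.le, ← Real.rpow_mul hβ.le, mul_comm]

theorem rpow_div_le {α β t x : ℝ} (hβ : 0 < β) (hx : 0 ≤ x) (h : β ^ t ≤ α) (n : ℕ) :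
    x ^ t / α ^ n ≤ (x / β ^ n) ^ t := by
  have : 0 < β ^ t := by positivity
  rw [rpow_div_pow hβ hx]
  gcongr

theorem rpow_div_le_mul {α β t x : ℝ} (hβ : 0 < β) (hx : 0 ≤ x) (h : β ^ t ≤ α) (n : ℕ) :
    x ^ t / α ^ (n + 1) ≤ β ^ t / α * (x / β ^ (n + 1)) ^ t := by
  have h1 : 0 < β ^ t := by positivity
  have h2 : 0 < α := h1.trans_le h
  rw [rpow_div_pow hβ hx, pow_succ, pow_succ]
  have e : β ^ t / α * (x ^ t / ((β ^ t) ^ n * β ^ t)) = x ^ t / ((β ^ t) ^ n * α) := by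
    field_simp
  rw [e]
  gcongr

theorem strictMono_gap {θ : Fin q → ℕ} (hθ : StrictMono θ) {i j : Fin q} (h : i ≤ j) :
    (j : ℕ) + θ i ≤ θ j + i := by
  obtain ⟨j, hj⟩ := j
  induction j with
  | zero =>
    have : i = ⟨0, hj⟩ := le_antisymm h (Fin.le_def.2 (Nat.zero_le _))
    subst this; simp
  | succ j ih =>
    rcases h.eq_or_lt with rfl | hlt
    · simp [add_comm]
    · have h1 := ih (by omega) (Fin.le_def.2 (Nat.lt_succ_iff.1 (Fin.lt_def.1 hlt)))
      have h2 : θ ⟨j, by omega⟩ < θ ⟨j + 1, hj⟩ := hθ (Fin.lt_def.2 (Nat.lt_succ_self j))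
      simp only at h1 ⊢
      omega

/-- Near `0` the value in base `α` is controlled by the value in base `β`: both are governed by the
number of leading zeros. -/
theorem value_le_rpow {θ : Fin q → ℕ} (hθ : StrictMono θ) {α β t : ℝ} (hα : 1 < α) (hβ : 1 < β)
    (ht : 0 < t) (hβα : β ^ t ≤ α) {c : ℕ → Fin q}
    (hc : ∀ n, value α Fin.val (shift n c) ≤ 1) :
    value α Fin.val c ≤ β ^ t * value β θ c ^ t := by
  have hβ0 : 0 < β := by linarith
  have hα0 : 0 < α := by linarith
  have hV := value_nonneg hβ θ c
  by_cases hz : ∃ i, 1 ≤ (c i : ℕ)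
  · classical
    set n := Nat.find hz
    have hn : 1 ≤ (c n : ℕ) := Nat.find_spec hz
    have h0 : ∀ i < n, (c i : ℕ) = 0 := fun i hi => by
      have := Nat.find_min hz hi
      omega
    have e := value_eq_sum_add hα Fin.val c n
    rw [Finset.sum_eq_zero fun i hi => by rw [h0 i (Finset.mem_range.1 hi)]; simp, zero_add] at e
    have h1 : 1 ≤ θ (c n) :=
      (Nat.zero_le _).trans_lt (hθ (Fin.lt_def.2 hn : (⟨0, (c n).pos⟩ : Fin q) < c n))
    have h1' : (1 : ℝ) ≤ θ (c n) := by exact_mod_cast h1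
    have h2 : 1 / β ^ (n + 1) ≤ value β θ c :=
      le_trans (by gcongr) ((summable_value hβ θ c).le_tsum n fun j _ => by positivity)
    calc value α Fin.val c ≤ 1 ^ t / α ^ n := by rw [e, Real.one_rpow]; gcongr; exact hc n
      _ ≤ (1 / β ^ n) ^ t := rpow_div_le hβ0 zero_le_one hβα n
      _ = β ^ t * (1 / β ^ (n + 1)) ^ t := by
        rw [← Real.mul_rpow hβ0.le (by positivity), pow_succ]
        congr 1; field_simp
      _ ≤ β ^ t * value β θ c ^ t := by gcongr
  · push Not at hz
    have : value α Fin.val c = 0 := by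
      rw [value, tsum_congr fun i => by rw [Nat.lt_one_iff.1 (hz i), Nat.cast_zero, zero_div],
        tsum_zero]
    rw [this]; positivity

/-- The contribution of the digits at the first difference, together with the tail of the larger
sequence. -/
theorem gap_add_value_le {θ : Fin q → ℕ} (hθ : StrictMono θ) {α β t : ℝ} (hα : 1 < α) (hβ : 1 < β)
    (ht : 0 < t) (hβα : β ^ t ≤ α) {c : ℕ → Fin q}
    (hc : ∀ n, value α Fin.val (shift n c) ≤ 1) {i j : Fin q} (hij : i < j) {y : ℝ}
    (hy : ((θ j : ℝ) - θ i - 1) + value β θ c ≤ y) :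
    (((j : ℕ) : ℝ) - (i : ℕ) - 1) + value α Fin.val c ≤ (q + β ^ t) * y ^ t := by
  have hβ0 : 0 < β := by linarith
  have hV := value_nonneg hβ θ c
  have hgap : ((j : ℕ) : ℝ) + θ i ≤ θ j + (i : ℕ) := by exact_mod_cast strictMono_gap hθ hij.le
  have hlt : ((i : ℕ) : ℝ) + 1 ≤ (j : ℕ) := by exact_mod_cast Fin.lt_def.1 hij
  have hy0 : 0 ≤ y := by linarith
  have h1 : ((j : ℕ) : ℝ) - (i : ℕ) - 1 ≤ q * y ^ t := by
    by_cases he : (j : ℕ) = i + 1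
    · have : ((j : ℕ) : ℝ) = (i : ℕ) + 1 := by exact_mod_cast he
      rw [this]
      have : 0 ≤ (q : ℝ) * y ^ t := by positivity
      linarith
    · have h2 : (i : ℕ) + 2 ≤ j := by have := Fin.lt_def.1 hij; omega
      have h2' : ((i : ℕ) : ℝ) + 2 ≤ (j : ℕ) := by exact_mod_cast h2
      have h3 : 1 ≤ y ^ t := Real.one_le_rpow (by linarith) ht.le
      have h4 : ((j : ℕ) : ℝ) ≤ q := by exact_mod_cast j.2.le
      have h5 : (0 : ℝ) ≤ (i : ℕ) := by positivity
      have h6 : (q : ℝ) * 1 ≤ q * y ^ t := by gcongr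
      linarith
  have h2 : value α Fin.val c ≤ β ^ t * y ^ t :=
    (value_le_rpow hθ hα hβ ht hβα hc).trans (by gcongr; linarith)
  linarith

/-- Near `1` the value in base `α` is controlled by the value in base `β`. Comparing `c` with `ω`
and cutting at the first difference replaces `c` by a tail, at a cost that decays by the factor
`β ^ t / α < 1` at each cut; the costs sum up to a geometric series. -/
theorem one_sub_value_le {θ : Fin q → ℕ} (hθ : StrictMono θ) {α β t : ℝ} (hα : 1 < α) (hβ : 1 < β)
    (ht : 0 < t) (hβα : β ^ t < α) {ω : ℕ → Fin q} (hω : ω ∈ closure (admissible θ β))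
    (hdom : ∀ n, toLex (shift n ω) ≤ toLex ω) (hv : value α Fin.val ω = 1)
    {c : ℕ → Fin q} (hc : ∀ n, toLex (shift n c) < toLex ω) :
    1 - value α Fin.val c ≤
      (q + β ^ t) * (β ^ t / α) / (1 - β ^ t / α) * (1 - value β θ c) ^ t := by
  have hβ0 : 0 < β := by linarith
  have hα0 : 0 < α := by linarith
  have hβt : 0 < β ^ t := by positivity
  set ρ := β ^ t / α with hρ
  have hρ0 : 0 < ρ := by positivity
  have hρ1 : ρ < 1 := (div_lt_one hα0).2 hβα
  have hρ2 : 0 < 1 - ρ := by linarith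
  set K := (q + β ^ t) * ρ / (1 - ρ) with hK
  have hK0 : 0 ≤ K := by positivity
  have hKeq : ρ * ((q + β ^ t) + K) = K := by rw [hK]; field_simp; ring
  have hWω := value_shift_le_one hα Fin.val_strictMono fun n => ⟨ω, hv.le, hdom n⟩
  have key : ∀ N : ℕ, ∀ c : ℕ → Fin q, (∀ n, toLex (shift n c) < toLex ω) →
      1 - value α Fin.val c ≤ K * (1 - value β θ c) ^ t + 1 / α ^ N := by
    intro N
    induction N with
    | zero =>
      intro c hc
      have h1 := value_nonneg hα Fin.val c
      have h2 : 0 ≤ 1 - value β θ c :=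
        sub_nonneg.2 (mem_admissible_of_lex_lt hθ hβ hω hc 0).le
      have h3 : 0 ≤ K * (1 - value β θ c) ^ t := by positivity
      simp; linarith
    | succ N ih =>
      intro c hc
      obtain ⟨k, hk, hlt⟩ := toLex_lt_iff.1 (hc 0)
      rw [shift_zero] at hk hlt
      have hadm := mem_admissible_of_lex_lt hθ hβ hω hc
      have hW := value_sub_of_agree hα Fin.val hk
      have hV := value_sub_of_agree hβ θ hk
      have hVω := value_le_one_of_mem_closure hβ hω
      rw [hv] at hW
      have ihc := ih (shift (k + 1) c) fun n => by rw [shift_shift]; exact hc _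
      set r := ((θ (ω k) : ℝ) - θ (c k) - 1) + value β θ (shift (k + 1) ω) with hr
      set D := 1 - value β θ (shift (k + 1) c) with hD
      have hD0 : 0 ≤ D := sub_nonneg.2 (hadm (k + 1)).le
      have hθlt : (θ (c k) : ℝ) + 1 ≤ θ (ω k) := by exact_mod_cast hθ hlt
      have hr0 : 0 ≤ r := by linarith [value_nonneg hβ θ (shift (k + 1) ω)]
      have hgap := gap_add_value_le hθ hα hβ ht hβα.le (c := shift (k + 1) ω)
        (fun n => by rw [shift_shift]; exact hWω _) hlt le_rfl
      have h1 : ((ω k : ℕ) : ℝ) - (c k : ℕ) + value α Fin.val (shift (k + 1) ω) -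
          value α Fin.val (shift (k + 1) c) ≤ ((q + β ^ t) + K) * (r + D) ^ t + 1 / α ^ N := by
        have a1 : (q + β ^ t) * r ^ t ≤ (q + β ^ t) * (r + D) ^ t := by gcongr; linarith
        have a2 : K * D ^ t ≤ K * (r + D) ^ t := by gcongr; linarith
        linarith
      have h2 : (r + D) / β ^ (k + 1) ≤ 1 - value β θ c := by
        have : (r + D) / β ^ (k + 1) = value β θ ω - value β θ c := by
          rw [hV, hr, hD]; congr 1; ring
        linarith
      have h3 : (1 : ℝ) / α ^ N / α ^ (k + 1) ≤ 1 / α ^ (N + 1) := by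
        rw [div_div, ← pow_add]
        gcongr
        · exact hα.le
        · omega
      calc 1 - value α Fin.val c
          ≤ (((q + β ^ t) + K) * (r + D) ^ t + 1 / α ^ N) / α ^ (k + 1) := by rw [hW]; gcongr
        _ = ((q + β ^ t) + K) * ((r + D) ^ t / α ^ (k + 1)) + 1 / α ^ N / α ^ (k + 1) := by
          rw [add_div, mul_div_assoc]
        _ ≤ ((q + β ^ t) + K) * (ρ * (1 - value β θ c) ^ t) + 1 / α ^ (N + 1) := by
          refine add_le_add (mul_le_mul_of_nonneg_left ?_ (by positivity)) h3
          refine (rpow_div_le_mul hβ0 (by linarith) hβα.le k).trans ?_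
          gcongr
        _ = K * (1 - value β θ c) ^ t + 1 / α ^ (N + 1) := by
          rw [← mul_assoc, mul_comm _ ρ, hKeq]
  have hlim : Filter.Tendsto (fun N : ℕ => K * (1 - value β θ c) ^ t + 1 / α ^ N) Filter.atTop
      (𝓝 (K * (1 - value β θ c) ^ t + 0)) :=
    tendsto_const_nhds.add ((tendsto_pow_atTop_atTop_of_one_lt hα).const_div_atTop 1)
  rw [add_zero] at hlim
  exact ge_of_tendsto' hlim fun N => key N c hc

/-- Re-evaluating the sequences below `ω` in base `α` instead of `β` is a Hölder map of any exponent
`t` with `β ^ t < α`. -/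
theorem exists_holder_bound {θ : Fin q → ℕ} (hθ : StrictMono θ) {α β t : ℝ} (hα : 1 < α)
    (hβ : 1 < β) (ht : 0 < t) (hβα : β ^ t < α) {ω : ℕ → Fin q}
    (hω : ω ∈ closure (admissible θ β)) (hdom : ∀ n, toLex (shift n ω) ≤ toLex ω)
    (hv : value α Fin.val ω = 1) :
    ∃ K : ℝ, 0 ≤ K ∧ ∀ c c' : ℕ → Fin q, (∀ n, toLex (shift n c) < toLex ω) →
      (∀ n, toLex (shift n c') < toLex ω) →
      |value α Fin.val c - value α Fin.val c'| ≤ K * |value β θ c - value β θ c'| ^ t := by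
  have hβ0 : 0 < β := by linarith
  have hα0 : 0 < α := by linarith
  have hβt : 0 < β ^ t := by positivity
  have hρ1 : β ^ t / α < 1 := (div_lt_one hα0).2 hβα
  have hρ2 : 0 < 1 - β ^ t / α := by linarith
  set K := (q + β ^ t) * (β ^ t / α) / (1 - β ^ t / α) with hK
  have hK0 : 0 ≤ K := by positivity
  refine ⟨(q + β ^ t) + K, by positivity, ?_⟩
  have hWle : ∀ c : ℕ → Fin q, (∀ n, toLex (shift n c) < toLex ω) →
      ∀ n, value α Fin.val (shift n c) ≤ 1 := fun c hc =>
    value_shift_le_one hα Fin.val_strictMono fun n => ⟨ω, hv.le, (hc n).le⟩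
  intro c c' hc hc'
  wlog hlt : toLex c < toLex c' generalizing c c'
  · rcases (not_lt.1 hlt).eq_or_lt with heq | hl
    · rw [toLex_inj.1 heq, sub_self, sub_self, abs_zero, Real.zero_rpow ht.ne', mul_zero]
    · rw [abs_sub_comm, abs_sub_comm (value β θ c)]
      exact this c' c hc' hc hl
  have hadm := mem_admissible_of_lex_lt hθ hβ hω hc
  have hWmono := value_le_of_lex_le hα Fin.val_strictMono (hWle c hc) hlt.le
  have hVmono := value_le_of_lex_le hβ hθ (fun n => (hadm n).le) hlt.le
  obtain ⟨k, hk, hkl⟩ := toLex_lt_iff.1 hlt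
  rw [abs_sub_comm, abs_sub_comm (value β θ c), abs_of_nonneg (sub_nonneg.2 hWmono),
    abs_of_nonneg (sub_nonneg.2 hVmono), value_sub_of_agree hα Fin.val hk,
    value_sub_of_agree hβ θ hk]
  have hθlt : (θ (c k) : ℝ) + 1 ≤ θ (c' k) := by exact_mod_cast hθ hkl
  have hV' := value_nonneg hβ θ (shift (k + 1) c')
  have hD0 : 0 ≤ 1 - value β θ (shift (k + 1) c) := sub_nonneg.2 (hadm (k + 1)).le
  set y := (θ (c' k) : ℝ) - θ (c k) + value β θ (shift (k + 1) c') -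
    value β θ (shift (k + 1) c) with hy
  have hy0 : 0 ≤ y := by linarith
  have h1 := gap_add_value_le hθ hα hβ ht hβα.le (c := shift (k + 1) c')
    (fun n => by rw [shift_shift]; exact hWle c' hc' _) hkl (y := y) (by linarith)
  have h2 : 1 - value α Fin.val (shift (k + 1) c) ≤ K * y ^ t := by
    refine (one_sub_value_le hθ hα hβ ht hβα hω hdom hv (c := shift (k + 1) c)
      fun n => by rw [shift_shift]; exact hc _).trans ?_
    gcongr
    linarith
  calc _ ≤ ((q + β ^ t) + K) * y ^ t / α ^ (k + 1) := by gcongr; linarith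
    _ = ((q + β ^ t) + K) * (y ^ t / α ^ (k + 1)) := mul_div_assoc _ _ _
    _ ≤ _ := by gcongr; exact rpow_div_le hβ0 hy0 hβα.le _

/-- Every point of `[0, 1)` is the value in base `α` of a sequence whose tails lie strictly below
`ω`, namely of its digit sequence in base `α`. -/
theorem exists_value_eq {α : ℝ} (hα : 1 < α) (hαq : α ≤ q) {ω : ℕ → Fin q}
    (hdom : ∀ n, toLex (shift n ω) ≤ toLex ω) (hv : value α Fin.val ω = 1) {x : ℝ}
    (hx : x ∈ Ico (0 : ℝ) 1) :
    ∃ c : ℕ → Fin q, (∀ n, toLex (shift n c) < toLex ω) ∧ value α Fin.val c = x := by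
  have hα0 : 0 < α := by linarith
  have hlt : ∀ n, betaDigit α x n < q := by
    intro n
    have h := iterate_betaT_mem (β := α) hx n
    refine (Nat.floor_lt (mul_nonneg hα0.le h.1)).2 (lt_of_lt_of_le ?_ hαq)
    exact mul_lt_of_lt_one_right hα0 h.2
  obtain ⟨c, hc, -, hcx⟩ := exists_admissible_of_betaDigit hα hx (f := (Fin.val : Fin q → ℕ))
    fun n => ⟨⟨_, hlt n⟩, rfl⟩
  refine ⟨c, fun n => ?_, hcx⟩
  by_contra hle
  have h := value_le_of_lex_le hα Fin.val_strictMono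
    (value_shift_le_one hα Fin.val_strictMono fun n => ⟨ω, hv.le, hdom n⟩) (not_lt.1 hle)
  linarith [hc n]

theorem le_dimH_of_rpow_lt {θ : Fin q → ℕ} (hθ : StrictMono θ) {α β : ℝ} (hα : 1 < α)
    (hαq : α ≤ q) (hβ : 1 < β) {t : NNReal} (ht : 0 < t) (hβα : β ^ (t : ℝ) < α) {ω : ℕ → Fin q}
    (hω : ω ∈ closure (admissible θ β)) (hdom : ∀ n, toLex (shift n ω) ≤ toLex ω)
    (hv : value α Fin.val ω = 1) : (t : ENNReal) ≤ dimH (betaCantorSet θ β) := by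
  obtain ⟨K, hK, hbound⟩ := exists_holder_bound hθ hα hβ (NNReal.coe_pos.2 ht) hβα hω hdom hv
  let S : Set (ℕ → Fin q) := {c | ∀ n, toLex (shift n c) < toLex ω}
  have hSsub : value β θ '' S ⊆ betaCantorSet θ β := by
    rw [betaCantorSet_eq hβ]
    exact image_mono fun c hc => subset_closure (mem_admissible_of_lex_lt hθ hβ hω hc)
  have : Nonempty (ℕ → Fin q) := ⟨ω⟩
  let g : ℝ → ℝ := fun x => value α Fin.val (Function.invFunOn (value β θ) S x)
  have hg : ∀ c ∈ S, g (value β θ c) = value α Fin.val c := by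
    intro c hc
    have h1 := Function.invFunOn_mem (mem_image_of_mem (value β θ) hc)
    have h2 := Function.invFunOn_eq (mem_image_of_mem (value β θ) hc)
    have h3 := hbound _ c h1 hc
    rw [h2, sub_self, abs_zero, Real.zero_rpow (NNReal.coe_pos.2 ht).ne', mul_zero] at h3
    exact sub_eq_zero.1 (abs_nonpos_iff.1 h3)
  have hhold : HolderOnWith K.toNNReal t g (value β θ '' S) := by
    rintro _ ⟨c, hc, rfl⟩ _ ⟨c', hc', rfl⟩
    rw [hg c hc, hg c' hc', edist_dist, edist_dist, Real.dist_eq, Real.dist_eq,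
      ENNReal.ofReal_rpow_of_nonneg (abs_nonneg _) t.coe_nonneg, ← ENNReal.ofReal,
      ← ENNReal.ofReal_mul hK]
    exact ENNReal.ofReal_le_ofReal (hbound c c' hc hc')
  have himage : Ico (0 : ℝ) 1 ⊆ g '' (value β θ '' S) := by
    intro x hx
    obtain ⟨c, hc, hcx⟩ := exists_value_eq hα hαq hdom hv hx
    exact ⟨_, ⟨c, hc, rfl⟩, (hg c hc).trans hcx⟩
  have h1 : dimH (Ico (0 : ℝ) 1) = 1 := by
    rw [Real.dimH_of_nonempty_interior (by simp), Module.finrank_self]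
    exact Nat.cast_one
  have h2 : (1 : ENNReal) ≤ dimH (betaCantorSet θ β) / t :=
    calc (1 : ENNReal) ≤ dimH (g '' (value β θ '' S)) := h1 ▸ dimH_mono himage
      _ ≤ dimH (value β θ '' S) / t := hhold.dimH_image_le ht
      _ ≤ _ := by gcongr
  rwa [ENNReal.le_div_iff_mul_le (.inl (by exact_mod_cast ht.ne')) (.inl ENNReal.coe_ne_top),
    one_mul] at h2

/-! ### The dimension formula -/

/-- The Hausdorff dimension is the entropy `log α` of the digit shift divided by `log β`. -/
theorem dimH_of_isAlpha {θ : Fin q → ℕ} (hθ : StrictMono θ) {β α : ℝ} (hβ : 1 < β)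
    (h : IsAlpha θ β α) :
    dimH (betaCantorSet θ β) = ENNReal.ofReal (Real.log α / Real.log β) := by
  obtain ⟨h0, ω, hω, hmax, hs⟩ := (isAlpha_iff hθ hβ).1 h
  have hα := one_le_of_isAlpha hθ hβ h
  have hβ0 : 0 < β := by linarith
  have hlogβ : 0 < Real.log β := Real.log_pos hβ
  refine le_antisymm ?_ ?_
  · by_contra! hlt
    obtain ⟨d, hd1, hd2⟩ := ENNReal.lt_iff_exists_nnreal_btwn.1 hlt
    rw [ENNReal.ofReal_lt_coe_iff (div_nonneg (Real.log_nonneg hα) hlogβ.le),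
      div_lt_iff₀ hlogβ] at hd1
    refine hd2.not_ge (dimH_le_of_lt_rpow hβ hα hmax hs ?_)
    rwa [← Real.log_lt_log_iff h0 (by positivity), Real.log_rpow hβ0]
  · by_contra! hlt
    obtain ⟨t, ht1, ht2⟩ := ENNReal.lt_iff_exists_nnreal_btwn.1 hlt
    have ht : 0 < t := ENNReal.coe_pos.1 (zero_le.trans_lt ht1)
    rw [ENNReal.lt_ofReal_iff_toReal_lt ENNReal.coe_ne_top, ENNReal.coe_toReal,
      lt_div_iff₀ hlogβ] at ht2
    have hβα : β ^ (t : ℝ) < α := by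
      rwa [← Real.log_lt_log_iff (by positivity) h0, Real.log_rpow hβ0]
    have hα1 : 1 < α := lt_of_le_of_lt (Real.one_le_rpow hβ.le t.coe_nonneg) hβα
    exact ht1.not_ge (le_dimH_of_rpow_lt hθ hα1 (isAlpha_le_card hθ hβ h) hβ ht hβα hω
      (shift_le_of_max hω hmax) ((hasSum_value hα1 _ _).unique hs))

theorem dimH_eq {θ : Fin q → ℕ} (hθ : StrictMono θ) {β : ℝ} (hβ : 1 < β) :
    dimH (betaCantorSet θ β) = ENNReal.ofReal (Real.log (alpha θ β) / Real.log β) := by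
  by_cases h : ∃ α, IsAlpha θ β α
  · obtain ⟨α, h⟩ := h
    rw [alpha_eq hθ hβ h, dimH_of_isAlpha hθ hβ h]
  · have hsub : (betaCantorSet θ β).Subsingleton :=
      not_nontrivial_iff.1 fun hn => h (exists_isAlpha_of_nontrivial hθ hβ hn)
    rw [alpha_eq_one h, hsub.dimH_zero]
    simp

theorem continuousOn_dimH {θ : Fin q → ℕ} (hθ : StrictMono θ) :
    ContinuousOn (fun β => dimH (betaCantorSet θ β)) (betaRange θ) := by
  have hcont : ContinuousOn (alpha θ) (betaRange θ) := by
    by_cases hq : 2 ≤ q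
    · exact continuousOn_alpha hθ hq
    · refine (continuousOn_const (c := (1 : ℝ))).congr fun β hβ => alpha_eq_one ?_
      rintro ⟨α, h⟩
      obtain ⟨h0, ω, -, -, hs⟩ := (isAlpha_iff hθ hβ.1).1 h
      obtain ⟨i, hi⟩ := exists_pos_of_hasSum hs
      have := (ω i).2
      omega
  have hpos : ∀ β ∈ betaRange θ, alpha θ β ≠ 0 := by
    intro β hβ
    by_cases h : ∃ α, IsAlpha θ β α
    · obtain ⟨α, h⟩ := h
      rw [alpha_eq hθ hβ.1 h]
      exact h.1.ne'
    · rw [alpha_eq_one h]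
      exact one_ne_zero
  have hlog : ContinuousOn (fun β => Real.log (alpha θ β) / Real.log β) (betaRange θ) :=
    (hcont.log hpos).div (continuousOn_id.log fun β hβ => (zero_lt_one.trans hβ.1).ne')
      fun β hβ => (Real.log_pos hβ.1).ne'
  exact (ENNReal.continuous_ofReal.comp_continuousOn hlog).congr fun β hβ => dimH_eq hθ hβ.1

end BetaCantor

theorem theorem3 (q : ℕ) (hq : 1 ≤ q) (θ : Fin q → ℕ) (hθ : StrictMono θ) :
    ContinuousOn (fun β : ℝ => dimH (betaCantorSet θ β)) (betaRange θ) ∧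
    (∀ β ∈ betaRange θ, (betaCantorSet θ β).Nontrivial → ∃! α : ℝ, IsAlpha θ β α) ∧
    (∀ β ∈ betaRange θ, ∀ β' ∈ betaRange θ, β ≤ β' →
      ∀ α α' : ℝ, IsAlpha θ β α → IsAlpha θ β' α' → α ≤ α') ∧
    (2 ≤ q → ∀ α ∈ Set.Ioc ((q : ℝ) - 1) (q : ℝ), ∃ β ∈ betaRange θ, IsAlpha θ β α) := by
  refine ⟨BetaCantor.continuousOn_dimH hθ, fun β hβ hn => ?_, ?_, ?_⟩
  · obtain ⟨α, h⟩ := BetaCantor.exists_isAlpha_of_nontrivial hθ hβ.1 hn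
    exact ⟨α, h, fun α' h' => BetaCantor.isAlpha_unique hθ hβ.1 h' h⟩
  · exact fun β hβ β' _ hle α α' h h' => BetaCantor.isAlpha_le hθ hβ.1 hle h h'
  · exact fun hq2 α hα => BetaCantor.exists_isAlpha_eq hθ hq2 hα
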